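/- Let $n\ge 1$, let $\mathcal H_S$ be a complex Hilbert space, let $\Gamma_0$ be an orthogonal projection of finite rank on $\mathcal H_S$, and let $M_0,\dots,M_{n-1}$ be bounded operators on $\mathcal H_S$. Let $|0\rangle,\dots,|n-1\rangle$ be the standard basis of $\mathbb C^n$; all indices $i$ of $M_i$ and of $|i\rangle$ are read modulo $n$. On $\mathcal H_S\otimes\mathbb C^n$ put $P_0=\Gamma_0\otimes|0\rangle\langle 0|$, $H_0=-P_0$, $$V=\sum_{i=0}^{n-1}\bigl(M_i^\dagger\otimes|i+1\rangle\langle i|+M_i\otimes|i\rangle\langle i+1|\bigr),\qquad H(\lambda)=H_0+\lambda V\quad(\lambda\in\mathbb R),$$ and let $d$ be the rank of $P_0$. Write $A\propto B$ if $A=cB$ for some scalar $c\in\mathbb C$. Consider the constraints, for all $i$: (i) $M_iM_{i+1}M_{i+1}^\dagger M_i^\dagger\propto(M_iM_i^\dagger)^2$; (ii) $(M_iM_i^\dagger)^2\propto M_iM_i^\dagger$; (iii) $M_iM_i^\dagger\propto M_{i-1}^\dagger M_{i-1}$; (iv) $\Gamma_0M_0M_0^\dagger\Gamma_0\propto\Gamma_0$.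 These constraints hold whenever all $M_i$ are unitary. Whenever they hold, there are a function $f:\mathbb R\to\mathbb R$ and a constant $C$ such that for every real $\lambda$ with $16\,|\lambda|\max_i\|M_i\|<1$ the following is true. (a) The Bloch series $\mathcal U=\sum_{m\ge0}\lambda^m\mathcal U^{(m)}$ and $\mathcal A=\sum_{m\ge0}\lambda^m\mathcal A^{(m)}$ converge absolutely in operator norm. Here $\mathcal U^{(0)}=P_0$, $\mathcal A^{(0)}=0$ and, for $m\ge1$, $$\mathcal U^{(m)}=\sum_{\ell\in\mathcal P_m}S^{\ell_1}VS^{\ell_2}V\cdots VS^{\ell_m}VP_0,\qquad \mathcal A^{(m)}=\sum_{\ell\in\mathcal P_{m-1}}P_0VS^{\ell_1}VS^{\ell_2}\cdots VS^{\ell_{m-1}}VP_0,$$ where $S^0=-P_0$, $S^\ell=(-1)^\ell(1-P_0)$ for $\ell>0$ (the operators belonging to the shifted Hamiltonian $H_0+1$, whose ground energy is $0$), and $\mathcal P_m$ is the set of $m$-tuples of nonnegative integers with $\sum_{i\le m}\ell_i=m$ and $\sum_{i\le p}\ell_i\ge p$ for $1\le p\le m-1$. (b) $H(\lambda)$ has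 orthonormal eigenvectors $\varphi_1,\dots,\varphi_d$ belonging to its $d$ lowest energies $E_1,\dots,E_d$; that is, $H(\lambda)\varphi_j=E_j\varphi_j$, and $\langle\psi,H(\lambda)\psi\rangle\ge E_j\|\psi\|^2$ for every $j$ and every $\psi$ orthogonal to all $\varphi_k$. For every choice of such $\varphi_j,E_j$ the sums of the Bloch series satisfy $\mathcal U P_0\varphi_j=\varphi_j$ and $\mathcal A P_0\varphi_j=(E_j+1)P_0\varphi_j$ for all $j$. (c) For every such choice, the shifted effective Hamiltonian $\tilde H_{\mathrm{eff}}(\delta)=\sum_jE_j|\varphi_j\rangle\langle\varphi_j|-\delta\sum_j|\varphi_j\rangle\langle\varphi_j|$ satisfies $$\Bigl\|\tilde H_{\mathrm{eff}}(f(\lambda))-(-1)^{n-1}\lambda^n\bigl(\Gamma_0M_0\cdots M_{n-1}\Gamma_0+\Gamma_0M_{n-1}^\dagger\cdots M_0^\dagger\Gamma_0\bigr)\otimes|0\rangle\langle0|\Bigr\|\le C\,|\lambda|^{n+1}.$$ -/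

import Mathlib

open scoped TensorProduct

noncomputable section

namespace ClockGadget

/-! ### Effective Hamiltonians -/

section Effective

variable {K : Type*} [NormedAddCommGroup K] [InnerProductSpace ℂ K] {d : ℕ}

/-- `φ 0, …, φ (d-1)` are mutually orthogonal unit eigenvectors of `H` belonging to its `d` lowest
energies `e 0, …, e (d-1)`: on the orthogonal complement of the `φ j` the energy is nowhere below
any of the `e i`. -/
structure IsLowestEigenpairs (H : K →L[ℂ] K) (φ : Fin d → K) (e : Fin d → ℝ) : Prop where
  orthonormal : Orthonormal ℂ φ
  eigen : ∀ i, H (φ i) = (e i : ℂ) • φ i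
  lowest : ∀ i, ∀ ψ : K, (∀ j, inner ℂ (φ j) ψ = 0) → e i * ‖ψ‖ ^ 2 ≤ (inner ℂ ψ (H ψ)).re

/-- The effective Hamiltonian `∑ i, e i |φ i⟩⟨φ i|`. -/
def effectiveHamiltonian (φ : Fin d → K) (e : Fin d → ℝ) : K →L[ℂ] K :=
  ∑ i, (e i : ℂ) • InnerProductSpace.rankOne ℂ (φ i) (φ i)

/-- The projection `∑ i, |φ i⟩⟨φ i|` onto the support of the effective Hamiltonian. -/
def supportProjection (φ : Fin d → K) : K →L[ℂ] K :=
  ∑ i, InnerProductSpace.rankOne ℂ (φ i) (φ i)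

/-- The effective Hamiltonian with its energies shifted by `-δ` on its support. -/
def shiftedEffectiveHamiltonian (φ : Fin d → K) (e : Fin d → ℝ) (δ : ℝ) : K →L[ℂ] K :=
  effectiveHamiltonian φ e - (δ : ℂ) • supportProjection φ

end Effective

/-! ### Bloch's perturbation series -/

section Bloch

variable {K : Type*} [NormedAddCommGroup K] [InnerProductSpace ℂ K] {k : ℕ}

/-- The operators `S^ℓ` of an unperturbed Hamiltonian `∑ j, E j • P j` (spectral decomposition)
with ground energy `E 0 = 0`: for `ℓ > 0` the `ℓ`-th power of the reduced resolvent, and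
`-P 0` for `ℓ = 0`. -/
def resolventPow (E : Fin (k + 1) → ℝ) (P : Fin (k + 1) → K →L[ℂ] K) (l : ℕ) : K →L[ℂ] K :=
  if l = 0 then -P 0 else ∑ j : Fin k, ((-(E j.succ : ℂ))⁻¹ ^ l) • P j.succ

/-- The `m`-tuples of natural numbers with sum `m` all of whose partial sums of length `p < m`
are at least `p`. -/
def blochTuples (m : ℕ) : Finset (Fin m → ℕ) :=
  {l ∈ Finset.Nat.antidiagonalTuple m m | ∀ p < m, p ≤ ∑ i : Fin m with i.val < p, l i}

/-- The `m`-th coefficient `𝒰^(m) = ∑ S^{ℓ₁} V S^{ℓ₂} V ⋯ S^{ℓₘ} V P₀` over `ℓ ∈ blochTuples m`;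
for `m = 0` it is `P₀`. -/
def blochU (E : Fin (k + 1) → ℝ) (P : Fin (k + 1) → K →L[ℂ] K) (V : K →L[ℂ] K) (m : ℕ) :
    K →L[ℂ] K :=
  ∑ l ∈ blochTuples m, (List.ofFn fun i => resolventPow E P (l i) * V).prod * P 0

/-- The `m`-th coefficient `𝒜^(m) = ∑ P₀ V S^{ℓ₁} V S^{ℓ₂} ⋯ V S^{ℓₘ₋₁} V P₀` over
`ℓ ∈ blochTuples (m - 1)`; for `m = 0` it is `0`. -/
def blochA (E : Fin (k + 1) → ℝ) (P : Fin (k + 1) → K →L[ℂ] K) (V : K →L[ℂ] K) :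
    ℕ → K →L[ℂ] K
  | 0 => 0
  | m + 1 => ∑ l ∈ blochTuples m,
      P 0 * (List.ofFn fun i => V * resolventPow E P (l i)).prod * V * P 0

end Bloch

/-! ### The clock gadget -/

section Clock

variable {E : Type*} [NormedAddCommGroup E] [InnerProductSpace ℂ E] {n : ℕ}

/-- The bipartite Hilbert space `E ⊗ ℂⁿ`. -/
abbrev ClockSpace (E : Type*) [NormedAddCommGroup E] [InnerProductSpace ℂ E] (n : ℕ) : Type _ :=
  E ⊗[ℂ] EuclideanSpace ℂ (Fin n)

/-- The clock operator `|i⟩⟨j|` on `ℂⁿ`. -/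
def ketBra (i j : Fin n) : EuclideanSpace ℂ (Fin n) →L[ℂ] EuclideanSpace ℂ (Fin n) :=
  InnerProductSpace.rankOne ℂ (EuclideanSpace.single i (1 : ℂ)) (EuclideanSpace.single j (1 : ℂ))

/-- The projection `P₀ = Γ₀ ⊗ |0⟩⟨0|`. -/
def groundProjection [NeZero n] (Γ₀ : E →L[ℂ] E) : ClockSpace E n →L[ℂ] ClockSpace E n :=
  TensorProduct.mapL Γ₀ (ketBra 0 0)

variable [CompleteSpace E]

/-- The hopping perturbation `V = ∑ i, (M i)† ⊗ |i+1⟩⟨i| + M i ⊗ |i⟩⟨i+1|`, with clock labels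
modulo `n`. -/
def hopping [NeZero n] (M : Fin n → E →L[ℂ] E) : ClockSpace E n →L[ℂ] ClockSpace E n :=
  ∑ i, (TensorProduct.mapL (star (M i)) (ketBra (i + 1) i) +
    TensorProduct.mapL (M i) (ketBra i (i + 1)))

/-- The Hamiltonian `H = -P₀ + t V`. -/
def hamiltonian [NeZero n] (Γ₀ : E →L[ℂ] E) (M : Fin n → E →L[ℂ] E) (t : ℝ) :
    ClockSpace E n →L[ℂ] ClockSpace E n :=
  -groundProjection Γ₀ + (t : ℂ) • hopping M

/-- The coefficients `𝒰^(m)` for the unperturbed Hamiltonian `1 - P₀ = 0 • P₀ + 1 • (1 - P₀)`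
(that is, `-P₀` shifted to ground energy `0`) and the hopping perturbation. -/
def clockU [NeZero n] (Γ₀ : E →L[ℂ] E) (M : Fin n → E →L[ℂ] E) (m : ℕ) :
    ClockSpace E n →L[ℂ] ClockSpace E n :=
  blochU ![0, 1] ![groundProjection Γ₀, 1 - groundProjection Γ₀] (hopping M) m

/-- The coefficients `𝒜^(m)` for the same data. -/
def clockA [NeZero n] (Γ₀ : E →L[ℂ] E) (M : Fin n → E →L[ℂ] E) (m : ℕ) :
    ClockSpace E n →L[ℂ] ClockSpace E n :=
  blochA ![0, 1] ![groundProjection Γ₀, 1 - groundProjection Γ₀] (hopping M) m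

/-- `A ∝ B`: there is a scalar `c` with `A = c B`. -/
def Proportional (A B : E →L[ℂ] E) : Prop := ∃ c : ℂ, A = c • B

/-- The four families of proportionality constraints, with indices modulo `n`. -/
structure ClockConstraints [NeZero n] (Γ₀ : E →L[ℂ] E) (M : Fin n → E →L[ℂ] E) : Prop where
  nested : ∀ i, Proportional (M i * M (i + 1) * star (M (i + 1)) * star (M i))
    ((M i * star (M i)) ^ 2)
  square : ∀ i, Proportional ((M i * star (M i)) ^ 2) (M i * star (M i))
  consecutive : ∀ i, Proportional (M i * star (M i)) (star (M (i - 1)) * M (i - 1))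
  ground : Proportional (Γ₀ * M 0 * star (M 0) * Γ₀) Γ₀

/-- The target Hamiltonian `Γ₀ M₀ ⋯ Mₙ₋₁ Γ₀ + Γ₀ Mₙ₋₁† ⋯ M₀† Γ₀`. -/
def targetHamiltonian (Γ₀ : E →L[ℂ] E) (M : Fin n → E →L[ℂ] E) : E →L[ℂ] E :=
  Γ₀ * (List.ofFn M).prod * Γ₀ + Γ₀ * (List.ofFn fun i => star (M i.rev)).prod * Γ₀

end Clock

end ClockGadget

end

/-!
The proof has an analytic and a combinatorial half, joined by a recursion for Bloch's coefficients.

Reading the tuples `ℓ` as lattice paths with steps `ℓᵢ - 1`, a first-passage decomposition gives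
`𝒰^(m+1) = -V 𝒰^(m) + ∑_{k+j=m} 𝒰^(k) V 𝒰^(j)` and `𝒜^(m+1) = P₀ V 𝒰^(m)`
(`pathSum_recursion`, `blochU_succ`, `blochA_succ_eq`), and weighting the paths geometrically gives
`‖𝒰^(m+1)‖ ≤ 2 ‖V‖ (4 ‖V‖)^m`.

The hopping operator is a sum of two block permutations, so `‖V‖ ≤ 2 maxᵢ ‖Mᵢ‖` and the hypothesis
on `t` says `|t| ‖V‖ < 1/8`. The series then converges, and its sum `U` solves Bloch's equation
`U = P₀ - W U + U W U` with `W = t V`, `P₀ U = P₀`, `U P₀ = U`. Hence `(H + 1) U = U A` with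
`A = P₀ W U`: the range of `U` is invariant under `H = -P₀ + W`. Since `‖U - P₀‖ ≤ 1/2`, the
energies on this range are at most `-3/5` and those on its complement at least `-2/5`
(`IsBlochWave.energy_le`, `IsBlochWave.energy_ge`). Therefore the lowest eigenvectors exist, every
choice of them spans the range of `U`, and `U` and `A` represent `H` on it. If `A` is `t^n T` up to
sign, a multiple of `P₀` and an error `O(t^(n+1))`, then so is the effective Hamiltonian
(`IsBlochWave.norm_shiftedEffectiveHamiltonian_sub_le`).

It remains to compute `𝒜^(m)` for `m ≤ n`. By the constraints every `Mᵢ` is a multiple of a partial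
isometry, and the initial projection of `Mᵢ₋₁` is the final projection of `Mᵢ`. Hence a clock
that moves away from site `0` and returns the same way picks up a scalar only, except for the factor
`M₀ M₀†` acting on the range of `Γ₀`, whose component in the ground space is scalar by the last
constraint. The recursion is followed on the span of the states within `m` hops of the ground
space (`IsClockModel.comp_site_zero_sub_mem`): below order `n` only scalars arise, and at order `n`
the clock can also go around the cycle in either direction, which produces the two terms of the
target Hamiltonian with the sign `(-1)^(n-1)` (`IsClockModel.exists_blochA_eq`).
-/

open scoped TensorProduct

noncomputable section

namespace ClockGadget

/-! ### Bloch's coefficients as lattice path sums -/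

section PathSums

open Finset.HasAntidiagonal (antidiagonal mem_antidiagonal)

variable {R : Type*} [Ring R]

/-- The sum of `S^{ℓ₁} V S^{ℓ₂} V ⋯ S^{ℓₘ} V P` over the `m`-tuples with `h + ∑ ℓ = m` and
`h + ℓ₁ + ⋯ + ℓₚ ≥ p` for all `p`. The tuple is read as a lattice path from height `h` to height `0`
that stays nonnegative, the entry `ℓ` being a step of height `ℓ - 1`; the recursion splits off
the first step. The ranges of summation are cut off where the remaining path sum vanishes. -/
def pathSum (S : ℕ → R) (V P : R) : ℕ → ℕ → R
  | 0, 0 => P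
  | 0, _ + 1 => 0
  | m + 1, 0 => ∑ l ∈ Finset.range (m + 1), S (l + 1) * V * pathSum S V P m l
  | m + 1, h + 1 => ∑ l ∈ Finset.range (m + 1), S l * V * pathSum S V P m (h + l)

variable (S : ℕ → R) (V P : R)

theorem pathSum_eq_zero {m h : ℕ} (hmh : m < h) : pathSum S V P m h = 0 := by
  induction m generalizing h with
  | zero => obtain ⟨h, rfl⟩ : ∃ k, h = k + 1 := ⟨h - 1, by omega⟩; rfl
  | succ m ih =>
    obtain ⟨h, rfl⟩ : ∃ k, h = k + 1 := ⟨h - 1, by omega⟩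
    exact Finset.sum_eq_zero fun l _ => by rw [ih (by omega), mul_zero]

theorem pathSum_succ_zero {m N : ℕ} (hN : m + 1 ≤ N) :
    pathSum S V P (m + 1) 0 = ∑ l ∈ Finset.range N, S (l + 1) * V * pathSum S V P m l := by
  rw [pathSum]
  refine Finset.sum_subset (Finset.range_subset_range.2 hN) fun l _ hl => ?_
  rw [pathSum_eq_zero S V P (by simpa using hl), mul_zero]

theorem pathSum_succ_succ {m h N : ℕ} (hN : m + 1 ≤ h + N) :
    pathSum S V P (m + 1) (h + 1) =
      ∑ l ∈ Finset.range N, S l * V * pathSum S V P m (h + l) := by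
  rw [pathSum]
  rcases le_total N (m + 1) with h1 | h1
  · refine (Finset.sum_subset (Finset.range_subset_range.2 h1) fun l _ hl => ?_).symm
    have : N ≤ l := by simpa using hl
    rw [pathSum_eq_zero S V P (by omega), mul_zero]
  · refine Finset.sum_subset (Finset.range_subset_range.2 h1) fun l _ hl => ?_
    have : m + 1 ≤ l := by simpa using hl
    rw [pathSum_eq_zero S V P (by omega), mul_zero]

theorem pathSum_mul_self (hP : P * P = P) (m h : ℕ) :
    pathSum S V P m h * P = pathSum S V P m h := by
  induction m generalizing h with
  | zero => cases h <;> simp [pathSum, hP]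
  | succ m ih => cases h <;> simp [pathSum, Finset.sum_mul, mul_assoc, ih]

/-- First-passage decomposition: a path from height `h + 1` to `0` is cut at its first visit to
height `0`. The step that leads there has `ℓ = 0`, hence the operator `-P`, and before it the path
stays at height at least `1`. -/
theorem pathSum_succ_succ_eq_convolution (hS : S 0 = -P) (m h : ℕ) :
    pathSum S V P (m + 1) (h + 1) =
      -∑ p ∈ antidiagonal m, pathSum S V P p.1 h * V * pathSum S V P p.2 0 := by
  induction m generalizing h with
  | zero => cases h <;> simp [pathSum, hS]
  | succ m ih =>
    rw [Finset.Nat.sum_antidiagonal_succ]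
    cases h with
    | zero =>
      rw [pathSum_succ_succ S V P (N := m + 1 + 1) (by omega), Finset.sum_range_succ']
      have key : ∀ p ∈ antidiagonal m, pathSum S V P (p.1 + 1) 0 =
          ∑ l ∈ Finset.range (m + 1), S (l + 1) * V * pathSum S V P p.1 l := fun p hp =>
        pathSum_succ_zero S V P (by have := mem_antidiagonal.1 hp; omega)
      rw [Finset.sum_congr (s₁ := antidiagonal m) rfl fun p hp => by rw [key p hp]]
      simp only [Nat.zero_add, ih, Finset.sum_mul, mul_neg, Finset.mul_sum, hS]
      rw [Finset.sum_comm]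
      simp [mul_assoc, pathSum, add_comm]
    | succ h =>
      rw [pathSum_succ_succ S V P (N := m + 1 + 1) (by omega)]
      have key : ∀ p ∈ antidiagonal m, pathSum S V P (p.1 + 1) (h + 1) =
          ∑ l ∈ Finset.range (m + 1 + 1), S l * V * pathSum S V P p.1 (h + l) := fun p hp =>
        pathSum_succ_succ S V P (by have := mem_antidiagonal.1 hp; omega)
      rw [Finset.sum_congr (s₁ := antidiagonal m) rfl fun p hp => by rw [key p hp]]
      simp only [Nat.add_right_comm h 1, ih, Finset.sum_mul, mul_neg, Finset.mul_sum]
      rw [Finset.sum_comm]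
      simp [mul_assoc, pathSum]

/-- The recursion satisfied by Bloch's coefficients. In a path from `0` to `0` the first entry is
positive; lowering it by one changes the sign and leaves a path of the same kind, or one starting
at height `1`, to which the first-passage decomposition applies. -/
theorem pathSum_recursion (hS : S 0 = -P)
    (hS' : ∀ l, S (l + 1) = (-1) ^ (l + 1) * (1 - P)) (m : ℕ) :
    pathSum S V P (m + 1) 0 = -(V * pathSum S V P m 0) +
      ∑ p ∈ antidiagonal m, pathSum S V P p.1 0 * V * pathSum S V P p.2 0 := by
  have hSS : ∀ l, S (l + 1 + 1) = -S (l + 1) := fun l => by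
    rw [hS', hS', pow_succ]; simp
  have h1 : S 1 = P - 1 := by simpa using hS' 0
  cases m with
  | zero => simp [pathSum, h1, sub_mul]; abel
  | succ m =>
    rw [pathSum_succ_zero S V P (N := m + 1 + 1) le_rfl, Finset.sum_range_succ',
      Finset.Nat.sum_antidiagonal_succ]
    have key : ∀ p ∈ antidiagonal m, pathSum S V P (p.1 + 1) 0 =
        ∑ l ∈ Finset.range (m + 1), S (l + 1) * V * pathSum S V P p.1 l := fun p hp =>
      pathSum_succ_zero S V P (by have := mem_antidiagonal.1 hp; omega)
    rw [Finset.sum_congr (s₁ := antidiagonal m) rfl fun p hp => by rw [key p hp]]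
    simp only [pathSum_succ_succ_eq_convolution S V P hS, Finset.sum_mul, mul_neg,
      Finset.mul_sum, hSS, neg_mul,
      Finset.sum_neg_distrib, neg_neg]
    rw [Finset.sum_comm]
    simp only [zero_add, h1, sub_mul, one_mul, mul_assoc]
    rw [show pathSum S V P 0 0 = P from rfl]
    abel

theorem sum_antidiagonalTuple_succ {A : Type*} [AddCommMonoid A] (m N : ℕ)
    (g : (Fin (m + 1) → ℕ) → A) :
    ∑ l ∈ Finset.Nat.antidiagonalTuple (m + 1) N, g l =
      ∑ p ∈ antidiagonal N, ∑ l ∈ Finset.Nat.antidiagonalTuple m p.2, g (Fin.cons p.1 l) := by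
  rw [Finset.sum_sigma']
  refine Finset.sum_bij' (fun l _ => ⟨(l 0, ∑ i, Fin.tail l i), Fin.tail l⟩)
    (fun q _ => Fin.cons q.1.1 q.2) ?_ ?_ ?_ ?_ ?_
  · intro l hl
    rw [Finset.Nat.mem_antidiagonalTuple, Fin.sum_univ_succ] at hl
    simp [Finset.Nat.mem_antidiagonalTuple, Fin.tail, hl]
  · rintro ⟨⟨a, b⟩, l⟩ h
    simp only [Finset.mem_sigma, mem_antidiagonal, Finset.Nat.mem_antidiagonalTuple] at h
    simp [Finset.Nat.mem_antidiagonalTuple, Fin.sum_univ_succ, h.1, h.2]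
  · intro l _
    simp
  · rintro ⟨⟨a, b⟩, l⟩ h
    simp only [Finset.mem_sigma, mem_antidiagonal, Finset.Nat.mem_antidiagonalTuple] at h
    simp [h.2]
  · intro l _
    simp

/-- The defining recursion of `pathSum` does enumerate the tuples in Bloch's formula, here with an
arbitrary initial height. -/
theorem sum_tuples_eq_pathSum (m h N : ℕ) (hN : N + h = m) :
    ∑ l ∈ Finset.Nat.antidiagonalTuple m N with
      ∀ p < m, p ≤ h + ∑ i : Fin m with i.val < p, l i,
      (List.ofFn fun i => S (l i) * V).prod * P = pathSum S V P m h := by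
  induction m generalizing h N with
  | zero =>
    obtain ⟨rfl, rfl⟩ : N = 0 ∧ h = 0 := by omega
    simp [pathSum]
  | succ m ih =>
    have hcond : ∀ a b (l : Fin m → ℕ), a + b = N → ∑ i, l i = b →
        ((∀ p < m + 1, p ≤ h + ∑ i : Fin (m + 1) with i.val < p, (Fin.cons a l : _ → ℕ) i) ↔
          (1 ≤ h + a ∧ ∀ p < m, p ≤ (h + a - 1) + ∑ i : Fin m with i.val < p, l i)) := by
      intro a b l hab hl
      have hsum : ∀ p, ∑ i : Fin (m + 1) with i.val < p + 1, (Fin.cons a l : _ → ℕ) i =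
          a + ∑ i : Fin m with i.val < p, l i := fun p => by
        simp [Finset.sum_filter, Fin.sum_univ_succ]
      constructor
      · intro H
        have h1 : 1 ≤ h + a := by
          rcases Nat.eq_zero_or_pos m with rfl | hm
          · simp at hl; omega
          · have := H (0 + 1) (by omega)
            rw [hsum] at this
            simpa using this
        refine ⟨h1, fun p hp => ?_⟩
        have := H (p + 1) (by omega)
        rw [hsum] at this
        omega
      · rintro ⟨h1, H⟩ p hp
        cases p with
        | zero => omega
        | succ p =>
          rw [hsum]
          have := H p (by omega)
          omega
    rw [Finset.sum_filter, sum_antidiagonalTuple_succ]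
    have hinner : ∀ p ∈ antidiagonal N,
        (∑ l ∈ Finset.Nat.antidiagonalTuple m p.2,
          if ∀ q < m + 1, q ≤ h + ∑ i : Fin (m + 1) with i.val < q, (Fin.cons p.1 l : _ → ℕ) i then
            (List.ofFn fun i => S ((Fin.cons p.1 l : _ → ℕ) i) * V).prod * P else 0) =
          if 1 ≤ h + p.1 then S p.1 * V * pathSum S V P m (h + p.1 - 1) else 0 := by
      rintro ⟨a, b⟩ hab
      have hab' : a + b = N := mem_antidiagonal.1 hab
      split_ifs with h1
      · rw [← ih (h + a - 1) b (by omega), Finset.sum_filter, Finset.mul_sum]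
        refine Finset.sum_congr rfl fun l hl => ?_
        simp only [hcond a b l hab' (Finset.Nat.mem_antidiagonalTuple.1 hl), h1, true_and]
        split_ifs <;> simp [List.ofFn_succ, mul_assoc]
      · refine Finset.sum_eq_zero fun l hl => if_neg ?_
        rw [hcond a b l hab' (Finset.Nat.mem_antidiagonalTuple.1 hl)]
        exact fun H => h1 H.1
    rw [Finset.sum_congr rfl hinner,
      Finset.Nat.sum_antidiagonal_eq_sum_range_succ_mk]
    cases h with
    | zero =>
      obtain rfl : N = m + 1 := by omega
      rw [Finset.sum_range_succ', pathSum_succ_zero S V P le_rfl]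
      simp
    | succ h =>
      rw [pathSum_succ_succ S V P (N := N + 1) (by omega)]
      refine Finset.sum_congr rfl fun l _ => ?_
      rw [if_pos (by omega)]
      congr 2
      omega

end PathSums

section NormBound

variable {R : Type*} [NormedRing R] (S : ℕ → R) (V P : R)

/-- The weights `4 ^ m / 2 ^ h` dominate the number of paths and reproduce themselves under
the recursion. -/
theorem norm_pathSum_le (hP : ‖P‖ ≤ 1) (hS : ∀ l, ‖S l‖ ≤ 1) (m h : ℕ) :
    ‖pathSum S V P m h‖ ≤ (4 * ‖V‖) ^ m * (1 / 2) ^ h := by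
  induction m generalizing h with
  | zero => cases h <;> simp [pathSum, hP]
  | succ m ih =>
    have hgeom : ∀ N, ∑ l ∈ Finset.range N, (1 / 2 : ℝ) ^ l ≤ 2 := fun N => by
      rw [geom_sum_eq (by norm_num)]
      have : (0 : ℝ) ≤ (1 / 2) ^ N := by positivity
      rw [div_le_iff_of_neg (by norm_num)]
      linarith
    have hterm : ∀ k a, ‖S k * V * pathSum S V P m (h - 1 + a)‖ ≤
        ‖V‖ * ((4 * ‖V‖) ^ m * (1 / 2) ^ (h - 1)) * (1 / 2) ^ a := fun k a => by
      calc _ ≤ ‖S k‖ * ‖V‖ * ‖pathSum S V P m (h - 1 + a)‖ :=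
            (norm_mul_le _ _).trans (by gcongr; exact norm_mul_le _ _)
        _ ≤ 1 * ‖V‖ * ((4 * ‖V‖) ^ m * (1 / 2) ^ (h - 1 + a)) := by
            gcongr
            exacts [hS k, ih _]
        _ = _ := by rw [pow_add]; ring
    have hle : ‖pathSum S V P (m + 1) h‖ ≤
        ‖V‖ * ((4 * ‖V‖) ^ m * (1 / 2) ^ (h - 1)) * 2 := by
      refine le_trans ?_ (mul_le_mul_of_nonneg_left (hgeom (m + 1)) (by positivity))
      rw [Finset.mul_sum]
      cases h with
      | zero =>
        refine norm_sum_le_of_le _ fun l _ => ?_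
        simpa using hterm (l + 1) l
      | succ h =>
        refine norm_sum_le_of_le _ fun l _ => ?_
        simpa using hterm l l
    refine hle.trans ?_
    cases h with
    | zero =>
      rw [pow_succ]
      have : 0 ≤ (4 * ‖V‖) ^ m * ‖V‖ := by positivity
      simp only [Nat.zero_sub, pow_zero]
      linarith
    | succ h =>
      simp only [Nat.add_sub_cancel, pow_succ]
      exact le_of_eq (by ring)

theorem norm_pathSum_succ_zero_le (hP : ‖P‖ ≤ 1) (hS : ∀ l, ‖S l‖ ≤ 1) (m : ℕ) :
    ‖pathSum S V P (m + 1) 0‖ ≤ 2 * ‖V‖ * (4 * ‖V‖) ^ m := by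
  have h1 : ‖pathSum S V P (m + 1) 0‖ ≤
      ∑ l ∈ Finset.range (m + 1), ‖V‖ * (4 * ‖V‖) ^ m * (1 / 2) ^ l := by
    refine norm_sum_le_of_le _ fun l _ => ?_
    calc _ ≤ ‖S (l + 1)‖ * ‖V‖ * ‖pathSum S V P m l‖ :=
          (norm_mul_le _ _).trans (by gcongr; exact norm_mul_le _ _)
      _ ≤ 1 * ‖V‖ * ((4 * ‖V‖) ^ m * (1 / 2) ^ l) := by
          gcongr
          exacts [hS _, norm_pathSum_le S V P hP hS m l]
      _ = _ := by ring
  refine h1.trans ?_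
  rw [← Finset.mul_sum, geom_sum_eq (by norm_num)]
  have h2 : (0 : ℝ) ≤ (1 / 2) ^ (m + 1) := by positivity
  have h3 : ((1 / 2 : ℝ) ^ (m + 1) - 1) / (1 / 2 - 1) ≤ 2 := by
    rw [div_le_iff_of_neg (by norm_num)]
    linarith
  calc _ ≤ ‖V‖ * (4 * ‖V‖) ^ m * 2 := by gcongr
    _ = _ := by ring

end NormBound

section BlochCoefficients

variable {K : Type*} [NormedAddCommGroup K] [InnerProductSpace ℂ K] (P V : K →L[ℂ] K)

/-- The operators `S^ℓ` of `1 - P = 0 • P + 1 • (1 - P)`. -/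
abbrev gapResolventPow (l : ℕ) : K →L[ℂ] K := resolventPow ![0, 1] ![P, 1 - P] l

theorem gapResolventPow_zero : gapResolventPow P 0 = -P := by simp [resolventPow]

theorem gapResolventPow_succ (l : ℕ) :
    gapResolventPow P (l + 1) = (-1) ^ (l + 1) * (1 - P) := by
  simp only [resolventPow, Nat.succ_ne_zero, if_false, Finset.univ_unique, Fin.default_eq_zero,
    Finset.sum_singleton, Fin.succ_zero_eq_one, Matrix.cons_val_one, Matrix.cons_val_fin_one,
    Complex.ofReal_one, inv_neg, inv_one]
  rcases Nat.even_or_odd (l + 1) with h | h <;> simp [h.neg_one_pow]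

theorem blochU_eq_pathSum (m : ℕ) :
    blochU ![0, 1] ![P, 1 - P] V m = pathSum (gapResolventPow P) V P m 0 := by
  rw [← sum_tuples_eq_pathSum _ V P m 0 m rfl]
  simp [blochU, blochTuples]

theorem list_prod_ofFn_mul_shift {R : Type*} [Monoid R] (V : R) (m : ℕ) (s : Fin m → R) :
    (List.ofFn fun i => V * s i).prod * V = V * (List.ofFn fun i => s i * V).prod := by
  induction m with
  | zero => simp
  | succ m ih => simp [List.ofFn_succ, mul_assoc, ih]

/-- `𝒜 = P V 𝒰`, coefficientwise. -/
theorem blochA_succ_eq (m : ℕ) :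
    blochA ![0, 1] ![P, 1 - P] V (m + 1) = P * V * blochU ![0, 1] ![P, 1 - P] V m := by
  simp only [blochA, blochU, Finset.mul_sum]
  refine Finset.sum_congr rfl fun l _ => ?_
  rw [mul_assoc (_ : K →L[ℂ] K) (List.prod _) V, list_prod_ofFn_mul_shift]
  simp [mul_assoc]

theorem blochU_zero : blochU ![0, 1] ![P, 1 - P] V 0 = P := by
  rw [blochU_eq_pathSum]; rfl

theorem blochU_mul_self (hP : P * P = P) (m : ℕ) :
    blochU ![0, 1] ![P, 1 - P] V m * P = blochU ![0, 1] ![P, 1 - P] V m := by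
  rw [blochU_eq_pathSum, pathSum_mul_self _ _ _ hP]

theorem self_mul_blochU_succ (hP : P * P = P) (m : ℕ) :
    P * blochU ![0, 1] ![P, 1 - P] V (m + 1) = 0 := by
  rw [blochU_eq_pathSum, pathSum, Finset.mul_sum]
  refine Finset.sum_eq_zero fun l _ => ?_
  have h : P * gapResolventPow P (l + 1) = 0 := by
    rw [gapResolventPow_succ, ((Commute.neg_one_left (1 - P)).pow_left (l + 1)).eq, ← mul_assoc]
    simp [mul_sub, hP]
  rw [← mul_assoc, ← mul_assoc, h, zero_mul, zero_mul]

/-- Coefficientwise form of `𝒰 = P - V 𝒰 + 𝒰 V 𝒰`. -/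
theorem blochU_succ (m : ℕ) :
    blochU ![0, 1] ![P, 1 - P] V (m + 1) = -(V * blochU ![0, 1] ![P, 1 - P] V m) +
      ∑ p ∈ Finset.HasAntidiagonal.antidiagonal m,
        blochU ![0, 1] ![P, 1 - P] V p.1 * V * blochU ![0, 1] ![P, 1 - P] V p.2 := by
  simp only [blochU_eq_pathSum]
  exact pathSum_recursion _ V P (gapResolventPow_zero P) (gapResolventPow_succ P) m

theorem norm_blochU_succ_le (hP : ‖P‖ ≤ 1) (hQ : ‖1 - P‖ ≤ 1) (m : ℕ) :
    ‖blochU ![0, 1] ![P, 1 - P] V (m + 1)‖ ≤ 2 * ‖V‖ * (4 * ‖V‖) ^ m := by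
  rw [blochU_eq_pathSum]
  refine norm_pathSum_succ_zero_le _ V P hP (fun l => ?_) m
  cases l with
  | zero => rw [gapResolventPow_zero, norm_neg]; exact hP
  | succ l =>
    rw [gapResolventPow_succ]
    rcases Nat.even_or_odd (l + 1) with h | h
    · rw [h.neg_one_pow, one_mul]; exact hQ
    · rw [h.neg_one_pow, neg_one_mul, norm_neg]; exact hQ

end BlochCoefficients

/-! ### Bloch's equation and the separation of energies -/

section BlochEquation

variable {R : Type*} [NormedRing R] [CompleteSpace R]

theorem bloch_equation_of_recursion {u : ℕ → R} {W X : R} (hs : Summable fun m => ‖u m‖)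
    (hX : HasSum u X)
    (hu : ∀ m, u (m + 1) = -(W * u m) +
      ∑ p ∈ Finset.HasAntidiagonal.antidiagonal m, u p.1 * W * u p.2) :
    X = u 0 - W * X + X * W * X := by
  have hs' : Summable fun m => ‖u m * W‖ :=
    Summable.of_nonneg_of_le (fun _ => norm_nonneg _) (fun _ => norm_mul_le _ _) (hs.mul_right ‖W‖)
  have h1 : HasSum (fun m => ∑ p ∈ Finset.HasAntidiagonal.antidiagonal m, u p.1 * W * u p.2)
      (X * W * X) := by
    have := tsum_mul_tsum_eq_tsum_sum_antidiagonal_of_summable_norm hs' hs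
    rw [(hX.mul_right W).tsum_eq, hX.tsum_eq] at this
    rw [this]
    exact (summable_norm_sum_mul_antidiagonal_of_summable_norm hs' hs).of_norm.hasSum
  have h2 : HasSum (fun m => u (m + 1)) (-(W * X) + X * W * X) := by
    simp only [hu]
    exact (hX.mul_left W).neg.add h1
  have h3 := (hasSum_nat_add_iff' 1).2 hX
  have h4 := h2.unique h3
  simp only [Finset.range_one, Finset.sum_singleton] at h4
  calc X = u 0 + (X - u 0) := by abel
    _ = u 0 + (-(W * X) + X * W * X) := by rw [h4]
    _ = _ := by abel

end BlochEquation

section Separation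

variable {K : Type*} [NormedAddCommGroup K] [InnerProductSpace ℂ K]

theorem abs_re_inner_le {W : K →L[ℂ] K} {c : ℝ} (hW : ‖W‖ ≤ c) (x : K) :
    |(inner ℂ x (W x)).re| ≤ c * ‖x‖ ^ 2 := by
  calc _ ≤ ‖inner ℂ x (W x)‖ := Complex.abs_re_le_norm _
    _ ≤ ‖x‖ * ‖W x‖ := norm_inner_le_norm _ _
    _ ≤ ‖x‖ * (c * ‖x‖) := by gcongr; exact W.le_of_opNorm_le hW x
    _ = _ := by ring

variable [CompleteSpace K]

/-- `X` is the wave operator of the perturbation `W` of `-P`: it satisfies Bloch's equation with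
`P X = P` and `X P = X`. The perturbation is small compared with the gap `1`, and `X` is close
to `P`; the two numerical bounds are what separates the energies on the range of `X` from those
on its orthogonal complement. -/
structure IsBlochWave (P W X : K →L[ℂ] K) : Prop where
  isStarProjection : IsStarProjection P
  isSelfAdjoint : IsSelfAdjoint W
  self_mul : P * X = P
  mul_self : X * P = X
  equation : X = P - W * X + X * W * X
  norm_perturbation_le : ‖W‖ ≤ 1 / 8
  norm_sub_le : ‖X - P‖ ≤ 1 / 2

theorem inner_projection_comm {P : K →L[ℂ] K} (hP : IsStarProjection P) (x y : K) :
    inner ℂ (P x) y = inner ℂ x (P y) := by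
  rw [← ContinuousLinearMap.adjoint_inner_left, ← ContinuousLinearMap.star_eq_adjoint,
    hP.isSelfAdjoint.star_eq]

theorem re_inner_projection_self {P : K →L[ℂ] K} (hP : IsStarProjection P) (x : K) :
    (inner ℂ x (P x)).re = ‖P x‖ ^ 2 := by
  have h : P x = P (P x) := by
    conv_lhs => rw [← hP.isIdempotentElem.eq]
    rfl
  rw [h, ← inner_projection_comm hP, ← h]
  exact inner_self_eq_norm_sq (𝕜 := ℂ) _

theorem norm_sq_eq_projection_add {P : K →L[ℂ] K} (hP : IsStarProjection P) (x : K) :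
    ‖x‖ ^ 2 = ‖P x‖ ^ 2 + ‖x - P x‖ ^ 2 := by
  have h := re_inner_projection_self hP x
  have h2 := norm_sub_sq (𝕜 := ℂ) x (P x)
  simp only [RCLike.re_to_complex] at h2
  rw [h] at h2
  linarith

namespace IsBlochWave

variable {P W X : K →L[ℂ] K} (h : IsBlochWave P W X)
include h

/-- The range of `X` is invariant under `-P + W`, which acts on it through `P W X - 1`. -/
theorem intertwines : (-P + W) * X = X * (P * W * X) - X := by
  have h1 := h.equation
  rw [← mul_assoc, ← mul_assoc, h.mul_self, add_mul, neg_mul, h.self_mul]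
  nth_rewrite 4 [h1]
  abel

theorem apply_projection (y : K) : X (P y) = X y :=
  DFunLike.congr_fun h.mul_self y

theorem projection_apply (y : K) : P (X y) = P y :=
  DFunLike.congr_fun h.self_mul y

theorem mem_range_iff (φ : K) : φ ∈ LinearMap.range X.toLinearMap ↔ X (P φ) = φ := by
  constructor
  · rintro ⟨y, rfl⟩
    change X (P (X y)) = X y
    rw [h.projection_apply, h.apply_projection]
  · exact fun hφ => ⟨P φ, hφ⟩

theorem norm_sub_projection_le {x : K} (hx : P x = x) : ‖X x - x‖ ≤ 1 / 2 * ‖x‖ := by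
  have := (X - P).le_of_opNorm_le h.norm_sub_le x
  simpa [hx] using this

/-- On the range of `X` the energy is at most `-3/5`. -/
theorem energy_le {φ : K} (hφ : φ ∈ LinearMap.range X.toLinearMap) :
    (inner ℂ φ ((-P + W) φ)).re ≤ -(3 / 5) * ‖φ‖ ^ 2 := by
  have hP := h.isStarProjection
  rw [h.mem_range_iff] at hφ
  have hPP : P (P φ) = P φ := DFunLike.congr_fun hP.isIdempotentElem.eq φ
  have h1 : ‖φ - P φ‖ ≤ 1 / 2 * ‖P φ‖ := by
    have := h.norm_sub_projection_le hPP
    rwa [hφ] at this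
  have h2 := norm_sq_eq_projection_add hP φ
  have h3 := re_inner_projection_self hP φ
  have h4 := (abs_le.1 (abs_re_inner_le h.norm_perturbation_le φ)).2
  have h5 : ‖φ - P φ‖ ^ 2 ≤ (1 / 2 * ‖P φ‖) ^ 2 := by gcongr
  simp only [add_apply, neg_apply, inner_add_right,
    inner_neg_right, Complex.add_re, Complex.neg_re, h3]
  nlinarith

/-- On the orthogonal complement of the range of `X` the energy is at least `-2/5`. -/
theorem energy_ge {ψ : K} (hψ : ∀ y, inner ℂ (X y) ψ = 0) :
    -(2 / 5) * ‖ψ‖ ^ 2 ≤ (inner ℂ ψ ((-P + W) ψ)).re := by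
  have hP := h.isStarProjection
  have hPP : P (P ψ) = P ψ := DFunLike.congr_fun hP.isIdempotentElem.eq ψ
  have hle := h.norm_sub_projection_le hPP
  have h2 := norm_sq_eq_projection_add hP ψ
  have h3 := re_inner_projection_self hP ψ
  have h4 := (abs_le.1 (abs_re_inner_le h.norm_perturbation_le ψ)).1
  have h6 : inner ℂ (X (P ψ)) ψ = inner ℂ (P ψ) (P ψ) +
      inner ℂ (X (P ψ) - P ψ) (ψ - P ψ) := by
    have h7 : inner ℂ (P ψ) (P ψ) = inner ℂ (P ψ) ψ := by
      rw [← inner_projection_comm hP, hPP]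
    have h8 : inner ℂ (X (P ψ) - P ψ) (P ψ) = 0 := by
      rw [← inner_projection_comm hP, map_sub, h.projection_apply, sub_self, inner_zero_left]
    rw [inner_sub_right, h8, h7, inner_sub_left]
    ring
  rw [hψ] at h6
  have h9 : ‖P ψ‖ ^ 2 ≤ 1 / 2 * ‖P ψ‖ * ‖ψ - P ψ‖ := by
    have h10 : inner ℂ (P ψ) (P ψ) = -inner ℂ (X (P ψ) - P ψ) (ψ - P ψ) :=
      eq_neg_of_add_eq_zero_left h6.symm
    calc ‖P ψ‖ ^ 2 = ‖inner ℂ (P ψ) (P ψ)‖ := by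
          rw [inner_self_eq_norm_sq_to_K]; simp
      _ = ‖inner ℂ (X (P ψ) - P ψ) (ψ - P ψ)‖ := by rw [h10, norm_neg]
      _ ≤ ‖X (P ψ) - P ψ‖ * ‖ψ - P ψ‖ := norm_inner_le_norm _ _
      _ ≤ _ := by gcongr
  simp only [add_apply, neg_apply, inner_add_right,
    inner_neg_right, Complex.add_re, Complex.neg_re, h3]
  have h11 : 2 * ‖P ψ‖ ≤ ‖ψ - P ψ‖ := by
    rcases (norm_nonneg (P ψ)).eq_or_lt with h0 | h0
    · rw [← h0]; simp
    · by_contra hcon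
      push Not at hcon
      nlinarith
  nlinarith [norm_nonneg (P ψ)]

theorem isSelfAdjoint_hamiltonian : IsSelfAdjoint (-P + W) :=
  h.isStarProjection.isSelfAdjoint.neg.add h.isSelfAdjoint

theorem inner_hamiltonian_comm (x y : K) :
    inner ℂ ((-P + W) x) y = inner ℂ x ((-P + W) y) := by
  rw [← ContinuousLinearMap.adjoint_inner_left, ← ContinuousLinearMap.star_eq_adjoint,
    h.isSelfAdjoint_hamiltonian.star_eq]

theorem hamiltonian_mem_range {φ : K} (hφ : φ ∈ LinearMap.range X.toLinearMap) :
    (-P + W) φ ∈ LinearMap.range X.toLinearMap := by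
  obtain ⟨y, rfl⟩ := hφ
  refine ⟨(P * W * X) y - y, ?_⟩
  have := DFunLike.congr_fun h.intertwines y
  rw [map_sub]
  exact this.symm

theorem range_eq_map : LinearMap.range X.toLinearMap =
    (LinearMap.range P.toLinearMap).map X.toLinearMap := by
  ext φ
  rw [h.mem_range_iff]
  constructor
  · exact fun hφ => ⟨P φ, ⟨φ, rfl⟩, hφ⟩
  · rintro ⟨_, ⟨y, rfl⟩, rfl⟩
    change X (P (X (P y))) = X (P y)
    rw [h.projection_apply, h.apply_projection, h.apply_projection]

theorem range_projection_eq_map : LinearMap.range P.toLinearMap =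
    (LinearMap.range X.toLinearMap).map P.toLinearMap := by
  ext φ
  constructor
  · rintro ⟨y, rfl⟩
    exact ⟨X y, ⟨y, rfl⟩, h.projection_apply y⟩
  · rintro ⟨_, ⟨y, rfl⟩, rfl⟩
    exact ⟨X y, rfl⟩

variable [FiniteDimensional ℂ (LinearMap.range P.toLinearMap)]

theorem finiteDimensional_range : FiniteDimensional ℂ (LinearMap.range X.toLinearMap) := by
  rw [h.range_eq_map]; infer_instance

theorem finrank_range_eq : Module.finrank ℂ (LinearMap.range X.toLinearMap) =
    Module.finrank ℂ (LinearMap.range P.toLinearMap) := by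
  have := h.finiteDimensional_range
  apply le_antisymm
  · rw [h.range_eq_map]; exact Submodule.finrank_map_le _ _
  · conv_lhs => rw [h.range_projection_eq_map]
    exact Submodule.finrank_map_le _ _

/-- The restriction of `-P + W` to the range of `X` is diagonalized; by the energy bounds its
eigenvalues lie below the energies on the complement. -/
theorem exists_isLowestEigenpairs :
    ∃ (φ : Fin (Module.finrank ℂ (LinearMap.range P.toLinearMap)) → K) (e : _ → ℝ),
      IsLowestEigenpairs (-P + W) φ e := by
  have := h.finiteDimensional_range
  set R := LinearMap.range X.toLinearMap with hR
  let T : R →ₗ[ℂ] R := (-P + W).toLinearMap.restrict fun φ hφ => h.hamiltonian_mem_range hφ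
  have hT : T.IsSymmetric := fun x y => h.inner_hamiltonian_comm x y
  have hd := h.finrank_range_eq
  let b := hT.eigenvectorBasis hd
  have heig : ∀ i, (-P + W) (b i : K) = (hT.eigenvalues hd i : ℂ) • (b i : K) := fun i =>
    congrArg Subtype.val (hT.apply_eigenvectorBasis hd i)
  have horth : Orthonormal ℂ fun i => (b i : K) :=
    b.orthonormal.comp_linearIsometry R.subtypeₗᵢ
  refine ⟨fun i => b i, hT.eigenvalues hd, horth, heig, fun i ψ hψ => ?_⟩
  have h1 : hT.eigenvalues hd i ≤ -(3 / 5) := by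
    have := h.energy_le (b i).2
    rw [heig, inner_smul_right, inner_self_eq_norm_sq_to_K, horth.1 i] at this
    simpa using this
  have h2 : ∀ φ ∈ R, inner ℂ φ ψ = 0 := fun φ hφ => by
    have h3 : φ = ∑ j, b.repr ⟨φ, hφ⟩ j • (b j : K) := by
      have := congrArg Subtype.val (b.sum_repr ⟨φ, hφ⟩)
      simpa using this.symm
    rw [h3, sum_inner]
    exact Finset.sum_eq_zero fun j _ => by rw [inner_smul_left, hψ j, mul_zero]
  refine le_trans ?_ (h.energy_ge fun y => h2 _ ⟨y, rfl⟩)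
  nlinarith [sq_nonneg ‖ψ‖]

variable {φ : Fin (Module.finrank ℂ (LinearMap.range P.toLinearMap)) → K}
  {e : Fin (Module.finrank ℂ (LinearMap.range P.toLinearMap)) → ℝ}

/-- Lowest eigenvectors lie in the range `R` of `X`. By the energy gap an eigenvector lies in `R`
or is orthogonal to it. In the second case the `φ j` are too few to span `R`, and a vector of `R`
orthogonal to all of them has an energy below that of the eigenvector. -/
theorem eigenvector_mem_range (hφ : IsLowestEigenpairs (-P + W) φ e) (i) :
    φ i ∈ LinearMap.range X.toLinearMap := by
  have := h.finiteDimensional_range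
  set R := LinearMap.range X.toLinearMap with hR
  set r : K := R.starProjection (φ i) with hr
  set s : K := φ i - r with hs
  have hrR : r ∈ R := R.starProjection_apply_mem _
  have hsR : ∀ x ∈ R, inner ℂ x s = 0 := fun x hx =>
    (R.mem_orthogonal s).1 (R.sub_starProjection_mem_orthogonal _) x hx
  have hHs : ∀ x ∈ R, inner ℂ x ((-P + W) s) = 0 := fun x hx => by
    rw [← h.inner_hamiltonian_comm]
    exact hsR _ (h.hamiltonian_mem_range hx)
  have hrs : φ i = r + s := by rw [hs]; abel
  -- both components are eigenvectors
  have hd : (-P + W) r - (e i : ℂ) • r = -((-P + W) s - (e i : ℂ) • s) := by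
    have := hφ.eigen i
    rw [hrs, map_add, smul_add] at this
    rw [eq_neg_iff_add_eq_zero, ← sub_eq_zero.2 this]
    abel
  have hdR : (-P + W) r - (e i : ℂ) • r ∈ R :=
    R.sub_mem (h.hamiltonian_mem_range hrR) (R.smul_mem _ hrR)
  have hd0 : (-P + W) r - (e i : ℂ) • r = 0 := by
    rw [← inner_self_eq_zero (𝕜 := ℂ)]
    nth_rewrite 2 [hd]
    rw [inner_neg_right, inner_sub_right, hHs _ hdR, inner_smul_right, hsR _ hdR]
    simp
  have hHr : (-P + W) r = (e i : ℂ) • r := sub_eq_zero.1 hd0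
  have hHs' : (-P + W) s = (e i : ℂ) • s := by
    rw [hd0] at hd
    exact sub_eq_zero.1 (neg_eq_zero.1 hd.symm)
  have her : e i * ‖r‖ ^ 2 ≤ -(3 / 5) * ‖r‖ ^ 2 := by
    have := h.energy_le hrR
    rw [hHr, inner_smul_right, inner_self_eq_norm_sq_to_K, RCLike.ofReal_eq_complex_ofReal,
      ← Complex.ofReal_pow, Complex.re_ofReal_mul, Complex.ofReal_re] at this
    exact this
  have hes : -(2 / 5) * ‖s‖ ^ 2 ≤ e i * ‖s‖ ^ 2 := by
    have := h.energy_ge (ψ := s) fun y => hsR _ ⟨y, rfl⟩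
    rw [hHs', inner_smul_right, inner_self_eq_norm_sq_to_K, RCLike.ofReal_eq_complex_ofReal,
      ← Complex.ofReal_pow, Complex.re_ofReal_mul, Complex.ofReal_re] at this
    exact this
  by_cases hs0 : s = 0
  · rw [hrs, hs0, add_zero]; exact hrR
  exfalso
  have hspos : 0 < ‖s‖ ^ 2 := by positivity
  have hei : -(2 / 5) ≤ e i := le_of_mul_le_mul_right hes hspos
  have hr0 : r = 0 := by
    by_contra hr0
    have hrpos : 0 < ‖r‖ ^ 2 := by positivity
    have := le_of_mul_le_mul_right her hrpos
    linarith
  -- a vector of `R` orthogonal to every `φ j`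
  let f : R →ₗ[ℂ] (Fin (Module.finrank ℂ (LinearMap.range P.toLinearMap)) → ℂ) :=
    LinearMap.pi fun j => (innerSL ℂ (φ j)).toLinearMap ∘ₗ R.subtype
  have hf : ¬ Function.Injective f := by
    rw [LinearMap.injective_iff_surjective_of_finrank_eq_finrank
      (by rw [h.finrank_range_eq, Module.finrank_fin_fun])]
    intro hsurj
    obtain ⟨x, hx⟩ := hsurj (fun _ => 1)
    have h1 : inner ℂ (φ i) (x : K) = 1 := congrFun hx i
    have h2 : inner ℂ (φ i) (x : K) = 0 := by
      rw [hrs, hr0, zero_add, ← inner_conj_symm, hsR _ x.2, map_zero]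
    rw [h2] at h1
    exact zero_ne_one h1
  rw [← LinearMap.ker_eq_bot, Submodule.eq_bot_iff] at hf
  push Not at hf
  obtain ⟨x, hx, hx0⟩ := hf
  have h1 := hφ.lowest i x fun j => congrFun (LinearMap.mem_ker.1 hx) j
  have h2 := h.energy_le x.2
  have hxpos : 0 < ‖(x : K)‖ ^ 2 := by
    have : (x : K) ≠ 0 := fun h0 => hx0 (Subtype.ext h0)
    positivity
  nlinarith

theorem mem_span (hφ : IsLowestEigenpairs (-P + W) φ e) (y : K) :
    X y ∈ Submodule.span ℂ (Set.range φ) := by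
  have := h.finiteDimensional_range
  have hle : Submodule.span ℂ (Set.range φ) ≤ LinearMap.range X.toLinearMap :=
    Submodule.span_le.2 (by rintro _ ⟨i, rfl⟩; exact h.eigenvector_mem_range hφ i)
  have heq := Submodule.eq_of_le_of_finrank_eq hle (by
    rw [finrank_span_eq_card hφ.orthonormal.linearIndependent, h.finrank_range_eq,
      Fintype.card_fin])
  rw [heq]
  exact ⟨y, rfl⟩

theorem apply_eigenvector (hφ : IsLowestEigenpairs (-P + W) φ e) (i) :
    X (P (φ i)) = φ i :=
  (h.mem_range_iff _).1 (h.eigenvector_mem_range hφ i)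

theorem effective_apply_eigenvector (hφ : IsLowestEigenpairs (-P + W) φ e) (i) :
    (P * W * X) (P (φ i)) = ((e i + 1 : ℝ) : ℂ) • P (φ i) := by
  have h1 := DFunLike.congr_fun h.intertwines (P (φ i))
  simp only [mul_apply_eq_comp, sub_apply,
    h.apply_eigenvector hφ i] at h1
  rw [hφ.eigen i] at h1
  have h2 := congrArg P h1
  rw [map_smul, map_sub, h.projection_apply] at h2
  have hPP : ∀ x, P (P x) = P x := DFunLike.congr_fun h.isStarProjection.isIdempotentElem.eq
  rw [hPP, eq_sub_iff_add_eq] at h2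
  simp only [mul_apply_eq_comp, h.apply_eigenvector hφ i, ← h2]
  push_cast
  rw [add_smul, one_smul]

end IsBlochWave

end Separation

/-! ### The effective Hamiltonian in terms of the wave operator -/

section SupportProjection

variable {K : Type*} [NormedAddCommGroup K] [InnerProductSpace ℂ K] {d : ℕ} {φ : Fin d → K}

theorem supportProjection_apply_self (hφ : Orthonormal ℂ φ) (i : Fin d) :
    supportProjection φ (φ i) = φ i := by
  simp [supportProjection, orthonormal_iff_ite.1 hφ]

theorem supportProjection_apply_of_mem_span (hφ : Orthonormal ℂ φ) {x : K}
    (hx : x ∈ Submodule.span ℂ (Set.range φ)) : supportProjection φ x = x := by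
  induction hx using Submodule.span_induction with
  | mem x hx => obtain ⟨i, rfl⟩ := hx; exact supportProjection_apply_self hφ i
  | zero => simp
  | add x y _ _ hx hy => rw [map_add, hx, hy]
  | smul a x _ hx => rw [map_smul, hx]

theorem mul_supportProjection (B : K →L[ℂ] K) :
    B * supportProjection φ = ∑ i, InnerProductSpace.rankOne ℂ (B (φ i)) (φ i) := by
  rw [supportProjection, Finset.mul_sum]
  exact Finset.sum_congr rfl fun i _ => InnerProductSpace.comp_rankOne _ _ _

variable [CompleteSpace K]

theorem isSelfAdjoint_effectiveHamiltonian (e : Fin d → ℝ) :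
    IsSelfAdjoint (effectiveHamiltonian φ e) := by
  simp [IsSelfAdjoint, effectiveHamiltonian, ContinuousLinearMap.star_eq_adjoint]

theorem isStarProjection_supportProjection (hφ : Orthonormal ℂ φ) :
    IsStarProjection (supportProjection φ) where
  isIdempotentElem := by
    rw [IsIdempotentElem, mul_supportProjection]
    simp only [supportProjection_apply_self hφ]
    rfl
  isSelfAdjoint := by
    simp [IsSelfAdjoint, supportProjection, ContinuousLinearMap.star_eq_adjoint]

end SupportProjection

section EffectiveHamiltonian

variable {K : Type*} [NormedAddCommGroup K] [InnerProductSpace ℂ K] [CompleteSpace K]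
  {P W X : K →L[ℂ] K} [FiniteDimensional ℂ (LinearMap.range P.toLinearMap)]
  {φ : Fin (Module.finrank ℂ (LinearMap.range P.toLinearMap)) → K}
  {e : Fin (Module.finrank ℂ (LinearMap.range P.toLinearMap)) → ℝ}

/-- `∑ i, (e i + 1) |φ i⟩⟨φ i| = X (P W X) ∑ i, |φ i⟩⟨φ i|`. -/
theorem IsBlochWave.effectiveHamiltonian_add_supportProjection (h : IsBlochWave P W X)
    (hφ : IsLowestEigenpairs (-P + W) φ e) :
    effectiveHamiltonian φ e + supportProjection φ =
      X * (P * W * X) * supportProjection φ := by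
  rw [mul_supportProjection, effectiveHamiltonian, supportProjection, ← Finset.sum_add_distrib]
  refine Finset.sum_congr rfl fun i _ => ?_
  have h1 : (X * (P * W * X)) (φ i) = ((e i + 1 : ℝ) : ℂ) • φ i := by
    have h2 := h.effective_apply_eigenvector hφ i
    rw [mul_apply_eq_comp, h.apply_projection] at h2
    rw [mul_apply_eq_comp, mul_apply_eq_comp, h2, map_smul, h.apply_eigenvector hφ]
  rw [h1]
  push_cast
  rw [add_smul, one_smul, map_add, map_smul]
  rfl

/-- If `P W X` is `τ T` up to a multiple `g` of `P` and an error `B`, then the effective Hamiltonian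
shifted by `g.re - 1` is close to `τ T`. The scalar `g` need not be real: the operator obtained
with `g` in place of its real part has the shifted effective Hamiltonian as its self-adjoint part,
and passing to self-adjoint parts does not increase the distance to the self-adjoint `τ T`. -/
theorem IsBlochWave.norm_shiftedEffectiveHamiltonian_sub_le (h : IsBlochWave P W X)
    (hφ : IsLowestEigenpairs (-P + W) φ e) {T B : K →L[ℂ] K} {g : ℂ} {τ : ℝ}
    (hT : IsSelfAdjoint T) (hTP : T * P = T) (hPT : P * T = T)
    (hA : P * W * X = g • P + (τ : ℂ) • T + B) :
    ‖shiftedEffectiveHamiltonian φ e (g.re - 1) - (τ : ℂ) • T‖ ≤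
      2 * |τ| * ‖T‖ * ‖X - P‖ + 3 / 2 * ‖B‖ := by
  set G := supportProjection φ with hGdef
  have hG : IsStarProjection G := isStarProjection_supportProjection hφ.orthonormal
  have hXPG : X * G = G := by
    rw [hGdef, mul_supportProjection]
    refine Finset.sum_congr rfl fun i _ => ?_
    rw [← h.apply_projection, h.apply_eigenvector hφ]
  have hGX : G * X = X := by
    ext y
    exact supportProjection_apply_of_mem_span hφ.orthonormal (h.mem_span hφ y)
  set Z : K →L[ℂ] K := effectiveHamiltonian φ e - (g - 1) • G with hZ
  have hZX : Z = X * ((τ : ℂ) • T + B) * G := by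
    have h1 := h.effectiveHamiltonian_add_supportProjection hφ
    rw [hA, mul_add, mul_add, add_mul, add_mul, mul_smul_comm, smul_mul_assoc, h.mul_self,
      ← hGdef, hXPG] at h1
    rw [hZ, sub_smul, one_smul, mul_add, add_mul]
    rw [← eq_sub_iff_add_eq] at h1
    rw [h1]
    abel
  have hreal : shiftedEffectiveHamiltonian φ e (g.re - 1) - (τ : ℂ) • T =
      (1 / 2 : ℂ) • ((Z - (τ : ℂ) • T) + star (Z - (τ : ℂ) • T)) := by
    have hg : ((g.re - 1 : ℝ) : ℂ) = (1 / 2 : ℂ) * ((g - 1) + star (g - 1)) := by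
      rw [Complex.star_def, Complex.add_conj]
      push_cast
      simp
    have hstar : star (Z - (τ : ℂ) • T) =
        effectiveHamiltonian φ e - star (g - 1) • G - (τ : ℂ) • T := by
      rw [star_sub, hZ, star_sub, star_smul, star_smul, hG.isSelfAdjoint.star_eq, hT.star_eq,
        (isSelfAdjoint_effectiveHamiltonian e).star_eq]
      simp
    rw [hstar, hZ, shiftedEffectiveHamiltonian, hg, ← hGdef]
    module
  have hnorm : ‖shiftedEffectiveHamiltonian φ e (g.re - 1) - (τ : ℂ) • T‖ ≤
      ‖Z - (τ : ℂ) • T‖ := by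
    rw [hreal, norm_smul]
    have := norm_add_le (Z - (τ : ℂ) • T) (star (Z - (τ : ℂ) • T))
    rw [norm_star] at this
    have h2 : ‖(1 / 2 : ℂ)‖ = 1 / 2 := by norm_num
    rw [h2]
    linarith
  have hX : ‖X‖ ≤ 3 / 2 := by
    have h1 := norm_add_le (X - P) P
    rw [sub_add_cancel] at h1
    linarith [h.norm_sub_le, h.isStarProjection.norm_le]
  have hcompl : ‖P * (1 - G)‖ ≤ ‖X - P‖ := by
    have h1 : star (P * (1 - G)) = (1 - G) * (P - X) := by
      rw [star_mul, h.isStarProjection.isSelfAdjoint.star_eq, star_sub, star_one,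
        hG.isSelfAdjoint.star_eq, mul_sub, sub_mul _ _ X, hGX, one_mul, sub_self, sub_zero]
    rw [← norm_star, h1, norm_sub_rev X P]
    refine (norm_mul_le _ _).trans ?_
    have := hG.one_sub.norm_le
    nlinarith [norm_nonneg (P - X)]
  refine hnorm.trans ?_
  have hsplit : Z - (τ : ℂ) • T =
      (τ : ℂ) • ((X - P) * T * G - T * (P * (1 - G))) + X * B * G := by
    rw [hZX, mul_add, add_mul, mul_smul_comm, smul_mul_assoc, sub_mul, sub_mul, hPT, ← mul_assoc T,
      hTP, mul_sub, mul_one, smul_sub, smul_sub, smul_sub]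
    abel
  rw [hsplit]
  have h1 : ‖(X - P) * T * G‖ ≤ ‖X - P‖ * ‖T‖ := by
    refine (norm_mul_le _ _).trans ?_
    have := norm_mul_le (X - P) T
    nlinarith [hG.norm_le, norm_nonneg ((X - P) * T)]
  have h2 : ‖T * (P * (1 - G))‖ ≤ ‖T‖ * ‖X - P‖ :=
    (norm_mul_le _ _).trans (by gcongr)
  have h3 : ‖X * B * G‖ ≤ 3 / 2 * ‖B‖ := by
    refine (norm_mul_le _ _).trans ?_
    have h4 : ‖X * B‖ ≤ 3 / 2 * ‖B‖ := (norm_mul_le _ _).trans (by gcongr)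
    nlinarith [hG.norm_le, norm_nonneg (X * B)]
  refine (norm_add_le _ _).trans (add_le_add ?_ h3)
  rw [norm_smul, Complex.norm_real, Real.norm_eq_abs]
  calc |τ| * ‖(X - P) * T * G - T * (P * (1 - G))‖
      ≤ |τ| * (‖X - P‖ * ‖T‖ + ‖T‖ * ‖X - P‖) := by
        gcongr
        exact (_root_.norm_sub_le _ _).trans (add_le_add h1 h2)
    _ = _ := by ring

end EffectiveHamiltonian

/-! ### The clock space and the hopping operator -/

section ClockSpace

theorem norm_sq_sum_of_pairwise_orthogonal {K ι : Type*} [NormedAddCommGroup K]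
    [InnerProductSpace ℂ K] [Fintype ι] (v : ι → K) (hv : ∀ i j, i ≠ j → inner ℂ (v i) (v j) = 0) :
    ‖∑ j, v j‖ ^ 2 = ∑ j, ‖v j‖ ^ 2 := by
  classical
  have h : (inner ℂ (∑ j, v j) (∑ j, v j) : ℂ) = ((∑ j, ‖v j‖ ^ 2 : ℝ) : ℂ) := by
    simp only [sum_inner, inner_sum]
    rw [Complex.ofReal_sum]
    refine Finset.sum_congr rfl fun i _ => ?_
    rw [Finset.sum_eq_single i (fun j _ hj => hv j i hj) (by simp), inner_self_eq_norm_sq_to_K]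
    simp
  rw [inner_self_eq_norm_sq_to_K, RCLike.ofReal_eq_complex_ofReal, ← Complex.ofReal_pow] at h
  exact Complex.ofReal_injective h

theorem isSelfAdjoint_sum_add_of_eq_star {K ι : Type*} [NormedAddCommGroup K]
    [InnerProductSpace ℂ K] [CompleteSpace K] [Fintype ι] {f g : ι → K →L[ℂ] K}
    (h : ∀ i, f i = star (g i)) : IsSelfAdjoint (∑ i, (f i + g i)) := by
  refine isSelfAdjoint_sum _ fun i _ => ?_
  rw [h]
  exact IsSelfAdjoint.star_add_self _

variable {E : Type*} [NormedAddCommGroup E] [InnerProductSpace ℂ E] {n : ℕ}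

/-- The vector `y ⊗ |j⟩`. -/
def siteVector (j : Fin n) (y : E) : ClockSpace E n := y ⊗ₜ[ℂ] EuclideanSpace.single j (1 : ℂ)

theorem siteVector_add (j : Fin n) (x y : E) :
    siteVector j (x + y) = siteVector j x + siteVector j y := TensorProduct.add_tmul _ _ _

theorem siteVector_smul (j : Fin n) (c : ℂ) (y : E) :
    siteVector j (c • y) = c • siteVector j y := (TensorProduct.smul_tmul' _ _ _).symm

theorem siteVector_zero (j : Fin n) : siteVector j (0 : E) = 0 := TensorProduct.zero_tmul _ _

theorem inner_siteVector (i j : Fin n) (x y : E) :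
    inner ℂ (siteVector i x) (siteVector j y) = if i = j then inner ℂ x y else 0 := by
  have h := orthonormal_iff_ite.1 (EuclideanSpace.orthonormal_single (𝕜 := ℂ) (ι := Fin n)) i j
  rw [siteVector, siteVector, TensorProduct.inner_tmul, h]
  split_ifs <;> simp

theorem ketBra_single (i j k : Fin n) :
    ketBra i j (EuclideanSpace.single k (1 : ℂ)) =
      if j = k then EuclideanSpace.single i (1 : ℂ) else 0 := by
  have h := orthonormal_iff_ite.1 (EuclideanSpace.orthonormal_single (𝕜 := ℂ) (ι := Fin n)) j k
  rw [ketBra, InnerProductSpace.rankOne_apply, h]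
  split_ifs <;> simp

theorem mapL_ketBra_siteVector (A : E →L[ℂ] E) (i j k : Fin n) (y : E) :
    TensorProduct.mapL A (ketBra i j) (siteVector k y) =
      if j = k then siteVector i (A y) else 0 := by
  rw [siteVector, TensorProduct.mapL_tmul, ketBra_single]
  split_ifs with h
  · rfl
  · rw [TensorProduct.tmul_zero]

theorem exists_eq_sum_siteVector (x : ClockSpace E n) :
    ∃ y : Fin n → E, x = ∑ j, siteVector j (y j) := by
  induction x using TensorProduct.induction_on with
  | zero => exact ⟨0, by simp [siteVector_zero]⟩
  | tmul x v =>
    refine ⟨fun j => v j • x, ?_⟩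
    have h : v = ∑ j, v j • EuclideanSpace.single j (1 : ℂ) := by
      have := (EuclideanSpace.basisFun (Fin n) ℂ).sum_repr v
      simpa using this.symm
    conv_lhs => rw [h]
    rw [TensorProduct.tmul_sum]
    exact Finset.sum_congr rfl fun j _ => by
      rw [siteVector, TensorProduct.smul_tmul]
  | add x y hx hy =>
    obtain ⟨a, rfl⟩ := hx
    obtain ⟨b, rfl⟩ := hy
    exact ⟨a + b, by simp [siteVector_add, Finset.sum_add_distrib]⟩

theorem norm_sq_sum_siteVector {σ : Fin n → Fin n} (hσ : Function.Injective σ) (y : Fin n → E) :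
    ‖∑ j, siteVector (σ j) (y j)‖ ^ 2 = ∑ j, ‖y j‖ ^ 2 := by
  refine (norm_sq_sum_of_pairwise_orthogonal (fun j => siteVector (σ j) (y j))
    fun i j hij => ?_).trans (Finset.sum_congr rfl fun j _ => ?_)
  · exact (inner_siteVector _ _ _ _).trans (if_neg fun h => hij (hσ h))
  · rw [siteVector, TensorProduct.norm_tmul]
    simp

theorem ext_siteVector {A B : ClockSpace E n →L[ℂ] ClockSpace E n}
    (h : ∀ j y, A (siteVector j y) = B (siteVector j y)) : A = B := by
  ext x
  obtain ⟨y, rfl⟩ := exists_eq_sum_siteVector x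
  simp only [map_sum, h]

/-- `E ⊗ ℂⁿ` is isometric to the `ℓ²` sum of `n` copies of `E`. -/
instance [CompleteSpace E] : CompleteSpace (ClockSpace E n) := by
  let f : PiLp 2 (fun _ : Fin n => E) →ₗᵢ[ℂ] ClockSpace E n :=
    { toFun := fun y => ∑ j, siteVector j (y j)
      map_add' := fun x y => by simp [siteVector_add, Finset.sum_add_distrib]
      map_smul' := fun c y => by simp [siteVector_smul, Finset.smul_sum]
      norm_map' := fun y => by
        have h := norm_sq_sum_siteVector Function.injective_id (fun j => y j)
        have h2 := PiLp.norm_sq_eq_of_L2 (fun _ : Fin n => E) y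
        rw [← h2] at h
        exact (sq_eq_sq₀ (norm_nonneg _) (norm_nonneg _)).1 h }
  have hf : Function.Surjective f := fun x => by
    obtain ⟨y, rfl⟩ := exists_eq_sum_siteVector x
    exact ⟨WithLp.toLp 2 y, rfl⟩
  exact (LinearIsometryEquiv.ofSurjective f hf).symm.toIsometryEquiv.completeSpace

/-- A block operator with one block in each row and column has at most the norm of its largest
block. -/
theorem norm_sum_mapL_ketBra_le {σ : Fin n → Fin n} (hσ : Function.Injective σ)
    (A : Fin n → E →L[ℂ] E) {c : ℝ} (hc : 0 ≤ c) (hA : ∀ j, ‖A j‖ ≤ c) :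
    ‖∑ j, TensorProduct.mapL (A j) (ketBra (σ j) j)‖ ≤ c := by
  refine ContinuousLinearMap.opNorm_le_bound _ hc fun x => ?_
  obtain ⟨y, rfl⟩ := exists_eq_sum_siteVector x
  have h : (∑ j, TensorProduct.mapL (A j) (ketBra (σ j) j)) (∑ j, siteVector j (y j)) =
      ∑ j, siteVector (σ j) (A j (y j)) := by
    simp [mapL_ketBra_siteVector, -TensorProduct.mapL_apply]
  rw [h]
  refine le_of_sq_le_sq ?_ (by positivity)
  rw [mul_pow, norm_sq_sum_siteVector hσ,
    show ‖∑ j, siteVector j (y j)‖ ^ 2 = _ from norm_sq_sum_siteVector Function.injective_id y,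
    Finset.mul_sum]
  refine Finset.sum_le_sum fun j _ => ?_
  rw [← mul_pow]
  gcongr
  exact (A j).le_of_opNorm_le (hA j) _

theorem adjoint_ketBra (i j : Fin n) : star (ketBra i j) = ketBra j i := by
  simp [ketBra, ContinuousLinearMap.star_eq_adjoint]

variable [NeZero n]

theorem groundProjection_siteVector (Γ₀ : E →L[ℂ] E) (k : Fin n) (y : E) :
    groundProjection Γ₀ (siteVector k y) = if 0 = k then siteVector 0 (Γ₀ y) else 0 :=
  mapL_ketBra_siteVector _ _ _ _ _

theorem finiteDimensional_range_groundProjection {Γ₀ : E →L[ℂ] E}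
    (hfin : FiniteDimensional ℂ (LinearMap.range Γ₀.toLinearMap)) :
    FiniteDimensional ℂ (LinearMap.range (groundProjection (n := n) Γ₀).toLinearMap) := by
  let f : E →ₗ[ℂ] ClockSpace E n :=
    (TensorProduct.mk ℂ E (EuclideanSpace ℂ (Fin n))).flip (EuclideanSpace.single 0 1)
  refine Submodule.finiteDimensional_of_le (S₂ := (LinearMap.range Γ₀.toLinearMap).map f) ?_
  rintro _ ⟨x, rfl⟩
  obtain ⟨y, rfl⟩ := exists_eq_sum_siteVector x
  refine ⟨Γ₀ (y 0), ⟨y 0, rfl⟩, ?_⟩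
  change siteVector 0 (Γ₀ (y 0)) = groundProjection Γ₀ (∑ j, siteVector j (y j))
  simp [groundProjection_siteVector]

variable [CompleteSpace E]

omit [NeZero n] in
theorem star_mapL_ketBra (A : E →L[ℂ] E) (i j : Fin n) :
    star (TensorProduct.mapL A (ketBra i j)) = TensorProduct.mapL (star A) (ketBra j i) := by
  rw [ContinuousLinearMap.star_eq_adjoint, TensorProduct.adjoint_mapL,
    ← ContinuousLinearMap.star_eq_adjoint, ← ContinuousLinearMap.star_eq_adjoint, adjoint_ketBra]


theorem isStarProjection_groundProjection {Γ₀ : E →L[ℂ] E} (hΓ : IsStarProjection Γ₀) :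
    IsStarProjection (groundProjection (n := n) Γ₀) where
  isIdempotentElem := ext_siteVector fun j y => by
    have h : Γ₀ (Γ₀ y) = Γ₀ y := DFunLike.congr_fun hΓ.isIdempotentElem.eq y
    rw [mul_apply_eq_comp, groundProjection_siteVector]
    split_ifs
    · rw [groundProjection_siteVector, if_pos rfl, h]
    · rw [map_zero]
  isSelfAdjoint := by
    rw [IsSelfAdjoint, groundProjection, star_mapL_ketBra, hΓ.isSelfAdjoint.star_eq]

theorem isSelfAdjoint_hopping (M : Fin n → E →L[ℂ] E) : IsSelfAdjoint (hopping M) := by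
  exact isSelfAdjoint_sum_add_of_eq_star fun i => (star_mapL_ketBra _ _ _).symm

theorem norm_hopping_le (M : Fin n → E →L[ℂ] E) : ‖hopping M‖ ≤ 2 * ⨆ i, ‖M i‖ := by
  have hc : ∀ i, ‖M i‖ ≤ ⨆ i, ‖M i‖ := le_ciSup (Set.finite_range _).bddAbove
  have h0 : 0 ≤ ⨆ i, ‖M i‖ := (norm_nonneg _).trans (hc 0)
  rw [hopping, Finset.sum_add_distrib, two_mul]
  refine (ContinuousLinearMap.opNorm_add_le _ _).trans (add_le_add ?_ ?_)
  · exact norm_sum_mapL_ketBra_le (add_left_injective 1) _ h0 fun j => by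
      rw [norm_star]; exact hc j
  · rw [← Equiv.sum_comp (Equiv.subRight (1 : Fin n))]
    simpa using norm_sum_mapL_ketBra_le (sub_left_injective (b := (1 : Fin n)))
      (fun j => M (j - 1)) h0 fun j => hc _

theorem hopping_siteVector (M : Fin n → E →L[ℂ] E) (k : Fin n) (y : E) :
    hopping M (siteVector k y) =
      siteVector (k + 1) (star (M k) y) + siteVector (k - 1) (M (k - 1) y) := by
  rw [hopping, Finset.sum_add_distrib, ← Equiv.sum_comp (Equiv.subRight (1 : Fin n))
    fun i => TensorProduct.mapL (M i) (ketBra i (i + 1))]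
  simp [add_apply, mapL_ketBra_siteVector, -TensorProduct.mapL_apply]

end ClockSpace

/-! ### Consequences of the constraints -/

section Constraints

theorem ofNat_add_one {n : ℕ} [NeZero n] (k : ℕ) : Fin.ofNat n k + 1 = Fin.ofNat n (k + 1) := by
  ext
  simp [Fin.val_add]

variable {E : Type*} [NormedAddCommGroup E] [InnerProductSpace ℂ E] [CompleteSpace E]

/-- If `A A†` is proportional to a projection, then `A` is proportional to a partial isometry. -/
theorem exists_star_mul_mul_star_eq_smul {A : E →L[ℂ] E}
    (hA : Proportional ((A * star A) ^ 2) (A * star A)) :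
    ∃ c : ℂ, star A * A * star A = c • star A := by
  obtain ⟨c, hc⟩ := hA
  refine ⟨c, ?_⟩
  rw [← sub_eq_zero, ← CStarRing.star_mul_self_eq_zero_iff]
  have h1 : A * (star A * A * star A - c • star A) = 0 := by
    rw [mul_sub, mul_smul_comm, ← hc, sq]
    simp [mul_assoc]
  have h2 : star (star A * A * star A - c • star A) = (A * star A - star c • 1) * A := by
    simp [sub_mul, mul_assoc]
  rw [h2, mul_assoc, h1, mul_zero]

variable {n : ℕ} [NeZero n] {Γ₀ : E →L[ℂ] E} {M : Fin n → E →L[ℂ] E}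

namespace ClockConstraints

variable (h : ClockConstraints Γ₀ M)
include h

theorem exists_star_mul_mul_star (i : Fin n) :
    ∃ c : ℂ, star (M i) * M i * star (M i) = c • star (M i) :=
  exists_star_mul_mul_star_eq_smul (h.square i)

theorem exists_mul_star_mul (i : Fin n) : ∃ c : ℂ, M i * star (M i) * M i = c • M i := by
  obtain ⟨c, hc⟩ := h.exists_star_mul_mul_star i
  refine ⟨star c, ?_⟩
  have := congrArg star hc
  simpa [mul_assoc] using this

/-- If one of the `M i` vanishes, all do. This makes the constraint `M_i M_i† ∝ M_{i-1}† M_{i-1}`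
symmetric, although `∝` is not. -/
theorem eq_zero_of_eq_zero {i : Fin n} (hi : M i = 0) (j : Fin n) : M j = 0 := by
  have hstep : ∀ k : Fin n, M k = 0 → M (k + 1) = 0 := fun k hk => by
    obtain ⟨c, hc⟩ := h.consecutive (k + 1)
    rw [add_sub_cancel_right, hk, mul_zero, smul_zero] at hc
    exact CStarRing.mul_star_self_eq_zero_iff _ |>.1 hc
  have hall : ∀ k : ℕ, M (i + Fin.ofNat n k) = 0 := fun k => by
    induction k with
    | zero => simpa using hi
    | succ k ih =>
      have : i + Fin.ofNat n (k + 1) = i + Fin.ofNat n k + 1 := by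
        rw [add_assoc, ofNat_add_one]
      rw [this]
      exact hstep _ ih
  have := hall (j - i).val
  rwa [Fin.ofNat_val_eq_self, add_sub_cancel] at this

theorem proportional_star_mul (i : Fin n) :
    Proportional (star (M (i - 1)) * M (i - 1)) (M i * star (M i)) := by
  obtain ⟨c, hc⟩ := h.consecutive i
  by_cases hc0 : c = 0
  · have hi : M i = 0 := by
      rw [hc0, zero_smul] at hc
      exact CStarRing.mul_star_self_eq_zero_iff _ |>.1 hc
    exact ⟨0, by simp [h.eq_zero_of_eq_zero hi (i - 1)]⟩
  · exact ⟨c⁻¹, by rw [hc, smul_smul, inv_mul_cancel₀ hc0, one_smul]⟩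

theorem exists_mul_star_mul_star_pred (i : Fin n) :
    ∃ c : ℂ, M (i + 1) * star (M (i + 1)) * star (M i) = c • star (M i) := by
  obtain ⟨a, ha⟩ := h.consecutive (i + 1)
  obtain ⟨b, hb⟩ := h.exists_star_mul_mul_star i
  rw [add_sub_cancel_right] at ha
  exact ⟨a * b, by rw [ha, smul_mul_assoc, hb, smul_smul]⟩

theorem exists_star_mul_mul_succ (i : Fin n) :
    ∃ c : ℂ, star (M (i - 1)) * M (i - 1) * M i = c • M i := by
  obtain ⟨a, ha⟩ := h.proportional_star_mul i
  obtain ⟨b, hb⟩ := h.exists_mul_star_mul i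
  exact ⟨a * b, by rw [ha, smul_mul_assoc, hb, smul_smul]⟩

theorem exists_mul_mul_star_succ (i : Fin n) :
    ∃ c : ℂ, M (i - 1) * (M i * star (M i)) = c • M (i - 1) := by
  obtain ⟨a, ha⟩ := h.consecutive i
  obtain ⟨b, hb⟩ := h.exists_mul_star_mul (i - 1)
  exact ⟨a * b, by rw [ha, mul_smul_comm, ← mul_assoc, hb, smul_smul]⟩

end ClockConstraints

end Constraints

section Chains

variable {n : ℕ} [NeZero n]

/-- The site reached from `0` by `j` hops upwards. -/
def rightSite (n : ℕ) [NeZero n] : ℕ → Fin n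
  | 0 => 0
  | j + 1 => rightSite n j + 1

/-- The site reached from `0` by `j` hops downwards. -/
def leftSite (n : ℕ) [NeZero n] : ℕ → Fin n
  | 0 => 0
  | j + 1 => leftSite n j - 1

theorem rightSite_eq_ofNat (j : ℕ) : rightSite n j = Fin.ofNat n j := by
  induction j with
  | zero => rfl
  | succ j ih => rw [rightSite, ih, ofNat_add_one]

theorem leftSite_eq_ofNat {j : ℕ} (hj : j ≤ n) : leftSite n j = Fin.ofNat n (n - j) := by
  induction j with
  | zero => ext; simp [leftSite]
  | succ j ih =>
    rw [leftSite, ih (by omega), sub_eq_iff_eq_add, ofNat_add_one]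
    congr 1
    omega

theorem rightSite_ne_zero {j : ℕ} (h0 : 0 < j) (hj : j < n) : 0 ≠ rightSite n j := by
  rw [rightSite_eq_ofNat]
  intro h
  have := congrArg Fin.val h
  simp [Nat.mod_eq_of_lt hj] at this
  omega

theorem leftSite_ne_zero {j : ℕ} (h0 : 0 < j) (hj : j < n) : 0 ≠ leftSite n j := by
  rw [leftSite_eq_ofNat hj.le]
  intro h
  have := congrArg Fin.val h
  simp [Nat.mod_eq_of_lt (show n - j < n by omega)] at this
  omega

theorem rightSite_self : rightSite n n = 0 := by
  rw [rightSite_eq_ofNat]; ext; simp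

theorem leftSite_self : leftSite n n = 0 := by
  rw [leftSite_eq_ofNat le_rfl]; ext; simp

variable {E : Type*} [NormedAddCommGroup E] [InnerProductSpace ℂ E] [CompleteSpace E]
  (Γ₀ : E →L[ℂ] E) (M : Fin n → E →L[ℂ] E)

/-- `M_{j-1}† ⋯ M_0† Γ₀`, with indices modulo `n`. -/
def rightProd : ℕ → E →L[ℂ] E
  | 0 => Γ₀
  | j + 1 => star (M (rightSite n j)) * rightProd j

/-- `M_{-j} ⋯ M_{-1} Γ₀`, with indices modulo `n`. -/
def leftProd : ℕ → E →L[ℂ] E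
  | 0 => Γ₀
  | j + 1 => M (leftSite n (j + 1)) * leftProd j

theorem rightProd_eq (j : ℕ) : rightProd Γ₀ M j =
    (List.ofFn fun i : Fin j => star (M (Fin.ofNat n (j - (i + 1))))).prod * Γ₀ := by
  induction j with
  | zero => simp [rightProd]
  | succ j ih =>
    rw [rightProd, ih, List.ofFn_succ, List.prod_cons, mul_assoc, rightSite_eq_ofNat]
    simp

omit [CompleteSpace E] in
theorem leftProd_eq {j : ℕ} (hj : j ≤ n) : leftProd Γ₀ M j =
    (List.ofFn fun i : Fin j => M (Fin.ofNat n (n - j + i))).prod * Γ₀ := by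
  induction j with
  | zero => simp [leftProd]
  | succ j ih =>
    rw [leftProd, ih (by omega), List.ofFn_succ, List.prod_cons, mul_assoc, leftSite_eq_ofNat hj]
    have h : ∀ i : Fin j, n - (j + 1) + (i.val + 1) = n - j + i := fun i => by omega
    simp [h]

theorem targetHamiltonian_eq :
    targetHamiltonian Γ₀ M = Γ₀ * leftProd Γ₀ M n + Γ₀ * rightProd Γ₀ M n := by
  rw [targetHamiltonian, leftProd_eq _ _ le_rfl, rightProd_eq, mul_assoc, mul_assoc]
  have h1 : (fun i : Fin n => M (Fin.ofNat n (n - n + i))) = M := by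
    ext i : 1
    simp
  have h2 : (fun i : Fin n => star (M (Fin.ofNat n (n - (i + 1))))) =
      fun i => star (M i.rev) := by
    ext i : 1
    congr 2
    ext
    simp only [Fin.val_ofNat, Fin.val_rev]
    exact Nat.mod_eq_of_lt (by omega)
  rw [h1, h2]

end Chains

/-! ### Excursions of the clock -/

section Excursions

variable {E K : Type*} [NormedAddCommGroup E] [InnerProductSpace ℂ E] [CompleteSpace E]
  [NormedAddCommGroup K] [InnerProductSpace ℂ K] {n : ℕ} [NeZero n]

/-- Operators `P` and `V` on a space `K` into which `E` is mapped by `s k`, once for each site `k`,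
that act on the images like the ground projection and the hopping perturbation on the vectors
`y ⊗ |k⟩`. -/
structure IsClockModel (s : Fin n → E →L[ℂ] K) (Γ₀ : E →L[ℂ] E) (M : Fin n → E →L[ℂ] E)
    (P V : K →L[ℂ] K) : Prop where
  idem : Γ₀ * Γ₀ = Γ₀
  constraints : ClockConstraints Γ₀ M
  projection_comp : ∀ k, P ∘L s k = if 0 = k then s 0 ∘L Γ₀ else 0
  hopping_comp : ∀ k, V ∘L s k = s (k + 1) ∘L star (M k) + s (k - 1) ∘L M (k - 1)

variable (s : Fin n → E →L[ℂ] K) (Γ₀ : E →L[ℂ] E) (M : Fin n → E →L[ℂ] E)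

/-- Clock at site `j` after `j` hops upwards from `Γ₀ ⊗ |0⟩`. -/
def rightState (j : ℕ) : E →L[ℂ] K := s (rightSite n j) ∘L rightProd Γ₀ M j

/-- Clock at site `-j` after `j` hops downwards from `Γ₀ ⊗ |0⟩`. -/
def leftState (j : ℕ) : E →L[ℂ] K := s (leftSite n j) ∘L leftProd Γ₀ M j

/-- The part orthogonal to the ground space of what a closed excursion from `Γ₀ ⊗ |0⟩` leads to. By
the constraints it is, up to a scalar, the same for all excursions. -/
def returnState : E →L[ℂ] K := s 0 ∘L ((1 - Γ₀) * (M 0 * star (M 0)) * Γ₀)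

/-- The span of the states orthogonal to the ground space that are within `k` hops of it. -/
def excursionSpan (k : ℕ) : Submodule ℂ (E →L[ℂ] K) :=
  Submodule.span ℂ ({returnState s Γ₀ M} ∪
    {x | ∃ j, 0 < j ∧ j ≤ k ∧ (x = rightState s Γ₀ M j ∨ x = leftState s Γ₀ M j)})

variable {s Γ₀ M}

theorem excursionSpan_mono {k l : ℕ} (h : k ≤ l) :
    excursionSpan s Γ₀ M k ≤ excursionSpan s Γ₀ M l := by
  refine Submodule.span_mono (Set.union_subset_union_right _ ?_)
  rintro x ⟨j, h0, hj, hx⟩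
  exact ⟨j, h0, hj.trans h, hx⟩

theorem returnState_mem (k : ℕ) : returnState s Γ₀ M ∈ excursionSpan s Γ₀ M k :=
  Submodule.subset_span (Or.inl rfl)

theorem rightState_mem {j k : ℕ} (h0 : 0 < j) (hj : j ≤ k) :
    rightState s Γ₀ M j ∈ excursionSpan s Γ₀ M k :=
  Submodule.subset_span (Or.inr ⟨j, h0, hj, Or.inl rfl⟩)

theorem leftState_mem {j k : ℕ} (h0 : 0 < j) (hj : j ≤ k) :
    leftState s Γ₀ M j ∈ excursionSpan s Γ₀ M k :=
  Submodule.subset_span (Or.inr ⟨j, h0, hj, Or.inr rfl⟩)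

omit [CompleteSpace E] in
theorem one_sub_comp_eq_self {P : K →L[ℂ] K} {x : E →L[ℂ] K} (hx : P ∘L x = 0) :
    (1 - P) ∘L x = x := by
  rw [ContinuousLinearMap.sub_comp, hx, sub_zero]; rfl

/-- `w` consists of a multiple of the ground space embedding and of a part in the span of the states
within `k` hops. -/
def IsReturn (s : Fin n → E →L[ℂ] K) (Γ₀ : E →L[ℂ] E) (M : Fin n → E →L[ℂ] E)
    (P : K →L[ℂ] K) (k : ℕ) (w : E →L[ℂ] K) : Prop :=
  (1 - P) ∘L w ∈ excursionSpan s Γ₀ M k ∧ ∃ c : ℂ, P ∘L w = c • (s 0 ∘L Γ₀)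

theorem IsReturn.smul {P : K →L[ℂ] K} {k : ℕ} {w : E →L[ℂ] K} (hw : IsReturn s Γ₀ M P k w) (c : ℂ) :
    IsReturn s Γ₀ M P k (c • w) := by
  obtain ⟨h1, d, h2⟩ := hw
  refine ⟨?_, c * d, ?_⟩
  · rw [ContinuousLinearMap.comp_smul]; exact Submodule.smul_mem _ _ h1
  · rw [ContinuousLinearMap.comp_smul, h2, smul_smul]

theorem IsReturn.of_mem {P : K →L[ℂ] K} {k : ℕ} {w : E →L[ℂ] K} (hw : w ∈ excursionSpan s Γ₀ M k)
    (hP : P ∘L w = 0) : IsReturn s Γ₀ M P k w :=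
  ⟨by rwa [one_sub_comp_eq_self hP], 0, by rw [hP, zero_smul]⟩

namespace IsClockModel

variable {P V : K →L[ℂ] K} (h : IsClockModel s Γ₀ M P V)
include h

theorem projection_rightState {j : ℕ} (h0 : 0 < j) (hj : j < n) :
    P ∘L rightState s Γ₀ M j = 0 := by
  rw [rightState, ← ContinuousLinearMap.comp_assoc, h.projection_comp,
    if_neg (rightSite_ne_zero h0 hj), ContinuousLinearMap.zero_comp]

theorem projection_leftState {j : ℕ} (h0 : 0 < j) (hj : j < n) :
    P ∘L leftState s Γ₀ M j = 0 := by
  rw [leftState, ← ContinuousLinearMap.comp_assoc, h.projection_comp,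
    if_neg (leftSite_ne_zero h0 hj), ContinuousLinearMap.zero_comp]

theorem isReturn_site_zero (k : ℕ) : IsReturn s Γ₀ M P k (s 0 ∘L ((M 0 * star (M 0)) * Γ₀)) := by
  have h1 : P ∘L (s 0 ∘L ((M 0 * star (M 0)) * Γ₀)) = s 0 ∘L (Γ₀ * (M 0 * star (M 0)) * Γ₀) := by
    rw [← ContinuousLinearMap.comp_assoc, h.projection_comp, if_pos rfl,
      ContinuousLinearMap.comp_assoc]
    rfl
  constructor
  · convert returnState_mem (s := s) (Γ₀ := Γ₀) (M := M) k using 1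
    rw [ContinuousLinearMap.sub_comp, h1, returnState, sub_mul, sub_mul, one_mul,
      ContinuousLinearMap.comp_sub]
    rfl
  · obtain ⟨c, hc⟩ := h.constraints.ground
    refine ⟨c, ?_⟩
    rw [h1, show Γ₀ * (M 0 * star (M 0)) * Γ₀ = c • Γ₀ by rw [← hc]; simp [mul_assoc],
      ContinuousLinearMap.comp_smul]

theorem hopping_initial : V ∘L (s 0 ∘L Γ₀) = rightState s Γ₀ M 1 + leftState s Γ₀ M 1 := by
  rw [← ContinuousLinearMap.comp_assoc, h.hopping_comp, ContinuousLinearMap.add_comp]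
  rfl

/-- A hop from site `j` leads on to site `j + 1`, or back to site `j - 1`, where
`M_{j-1} M_{j-1}†` acts as a scalar, or, for `j = 1`, to the ground space and the returned state. -/
theorem hopping_rightState {j : ℕ} (h0 : 0 < j) (hj : j < n) :
    ∃ w, V ∘L rightState s Γ₀ M j = rightState s Γ₀ M (j + 1) + w ∧ IsReturn s Γ₀ M P j w := by
  obtain ⟨j, rfl⟩ : ∃ i, j = i + 1 := ⟨j - 1, by omega⟩
  refine ⟨s (rightSite n j) ∘L
    (M (rightSite n j) * star (M (rightSite n j)) * rightProd Γ₀ M j), ?_, ?_⟩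
  · rw [rightState, ← ContinuousLinearMap.comp_assoc, h.hopping_comp, ContinuousLinearMap.add_comp,
      rightSite, add_sub_cancel_right]
    rfl
  · cases j with
    | zero => exact h.isReturn_site_zero _
    | succ j =>
      obtain ⟨c, hc⟩ := h.constraints.exists_mul_star_mul_star_pred (rightSite n j)
      have h1 : M (rightSite n (j + 1)) * star (M (rightSite n (j + 1))) * rightProd Γ₀ M (j + 1) =
          c • rightProd Γ₀ M (j + 1) := by
        rw [rightProd, ← mul_assoc, rightSite, hc, smul_mul_assoc]
      rw [h1, ContinuousLinearMap.comp_smul]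
      exact IsReturn.smul (IsReturn.of_mem (rightState_mem (by omega) (by omega))
        (h.projection_rightState (by omega) (by omega))) c

theorem hopping_leftState {j : ℕ} (h0 : 0 < j) (hj : j < n) :
    ∃ w, V ∘L leftState s Γ₀ M j = leftState s Γ₀ M (j + 1) + w ∧ IsReturn s Γ₀ M P j w := by
  obtain ⟨j, rfl⟩ : ∃ i, j = i + 1 := ⟨j - 1, by omega⟩
  refine ⟨s (leftSite n j) ∘L
    (star (M (leftSite n j - 1)) * M (leftSite n j - 1) * leftProd Γ₀ M j), ?_, ?_⟩
  · rw [leftState, ← ContinuousLinearMap.comp_assoc, h.hopping_comp, ContinuousLinearMap.add_comp,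
      leftSite, sub_add_cancel, add_comm]
    rfl
  · cases j with
    | zero =>
      obtain ⟨c, hc⟩ := h.constraints.proportional_star_mul 0
      rw [show leftSite n 0 = 0 from rfl, hc, smul_mul_assoc, ContinuousLinearMap.comp_smul]
      exact IsReturn.smul (h.isReturn_site_zero _) c
    | succ j =>
      obtain ⟨c, hc⟩ := h.constraints.exists_star_mul_mul_succ (leftSite n (j + 1))
      rw [leftProd, ← mul_assoc, hc, smul_mul_assoc, ContinuousLinearMap.comp_smul]
      exact IsReturn.smul (IsReturn.of_mem (leftState_mem (by omega) (by omega))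
        (h.projection_leftState (by omega) (by omega))) c

/-- From the returned state the hops lead to the same states as from the ground space, since
`M_0†` and `M_{-1}` absorb `M_0 M_0†` up to a scalar. -/
theorem hopping_returnState : ∃ a b : ℂ, V ∘L returnState s Γ₀ M =
    a • rightState s Γ₀ M 1 + b • leftState s Γ₀ M 1 := by
  obtain ⟨γ, hγ⟩ := h.constraints.ground
  obtain ⟨a, ha⟩ := h.constraints.exists_star_mul_mul_star 0
  obtain ⟨b, hb⟩ := h.constraints.exists_mul_mul_star_succ 0
  have h1 : (1 - Γ₀) * (M 0 * star (M 0)) * Γ₀ = (M 0 * star (M 0)) * Γ₀ - γ • Γ₀ := by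
    rw [sub_mul, sub_mul, one_mul, ← hγ]; simp [mul_assoc]
  have h2 : star (M 0) * ((1 - Γ₀) * (M 0 * star (M 0)) * Γ₀) = (a - γ) • (star (M 0) * Γ₀) := by
    rw [h1, mul_sub, ← mul_assoc, ← mul_assoc, ha, smul_mul_assoc, mul_smul_comm, sub_smul]
  have h3 : M (0 - 1) * ((1 - Γ₀) * (M 0 * star (M 0)) * Γ₀) = (b - γ) • (M (0 - 1) * Γ₀) := by
    rw [h1, mul_sub, ← mul_assoc, hb, smul_mul_assoc, mul_smul_comm, sub_smul]
  refine ⟨a - γ, b - γ, ?_⟩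
  rw [returnState, ← ContinuousLinearMap.comp_assoc, h.hopping_comp, ContinuousLinearMap.add_comp,
    ContinuousLinearMap.comp_assoc, ContinuousLinearMap.comp_assoc]
  change s (0 + 1) ∘L (star (M 0) * _) + s (0 - 1) ∘L (M (0 - 1) * _) = _
  rw [h2, h3, ContinuousLinearMap.comp_smul, ContinuousLinearMap.comp_smul]
  rfl

/-- As long as the cycle cannot be closed, a hop enlarges the span by one step, and its component in
the ground space is a scalar. -/
theorem hopping_excursionSpan {k : ℕ} (hk : k + 1 < n) {x : E →L[ℂ] K}
    (hx : x ∈ excursionSpan s Γ₀ M k) : IsReturn s Γ₀ M P (k + 1) (V ∘L x) := by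
  have hR : ∀ j, 0 < j → j ≤ k + 1 → IsReturn s Γ₀ M P (k + 1) (rightState s Γ₀ M j) :=
    fun j h0 hj => IsReturn.of_mem (rightState_mem h0 hj)
      (h.projection_rightState h0 (by omega))
  have hL : ∀ j, 0 < j → j ≤ k + 1 → IsReturn s Γ₀ M P (k + 1) (leftState s Γ₀ M j) :=
    fun j h0 hj => IsReturn.of_mem (leftState_mem h0 hj)
      (h.projection_leftState h0 (by omega))
  have hadd : ∀ v w, IsReturn s Γ₀ M P (k + 1) v → IsReturn s Γ₀ M P (k + 1) w →
      IsReturn s Γ₀ M P (k + 1) (v + w) := by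
    rintro v w ⟨h1, c, h2⟩ ⟨h3, d, h4⟩
    refine ⟨?_, c + d, ?_⟩
    · rw [ContinuousLinearMap.comp_add]; exact Submodule.add_mem _ h1 h3
    · rw [ContinuousLinearMap.comp_add, h2, h4, add_smul]
  have hmono : ∀ j w, j ≤ k → IsReturn s Γ₀ M P j w → IsReturn s Γ₀ M P (k + 1) w :=
    fun j w hj hw => ⟨excursionSpan_mono (by omega) hw.1, hw.2⟩
  induction hx using Submodule.span_induction with
  | mem x hx =>
    rcases hx with rfl | ⟨j, h0, hj, rfl | rfl⟩
    · obtain ⟨a, b, hab⟩ := h.hopping_returnState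
      rw [hab]
      exact hadd _ _ (IsReturn.smul (hR 1 one_pos (by omega)) a)
        (IsReturn.smul (hL 1 one_pos (by omega)) b)
    · obtain ⟨w, hw, hret⟩ := h.hopping_rightState h0 (by omega)
      rw [hw]
      exact hadd _ _ (hR _ (by omega) (by omega)) (hmono _ _ hj hret)
    · obtain ⟨w, hw, hret⟩ := h.hopping_leftState h0 (by omega)
      rw [hw]
      exact hadd _ _ (hL _ (by omega) (by omega)) (hmono _ _ hj hret)
  | zero => exact ⟨by simp, 0, by simp⟩
  | add x y _ _ hx hy => rw [ContinuousLinearMap.comp_add]; exact hadd _ _ hx hy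
  | smul c x _ hx => rw [ContinuousLinearMap.comp_smul]; exact IsReturn.smul hx c

theorem effective_scalar_of_mem {u : ℕ → K →L[ℂ] K} (hu0 : u 0 = P) {m : ℕ} (hm : m + 1 < n)
    (hmem : 0 < m → u m ∘L s 0 ∈ excursionSpan s Γ₀ M m) :
    ∃ c : ℂ, P ∘L V ∘L u m ∘L s 0 = c • (s 0 ∘L Γ₀) := by
  rcases Nat.eq_zero_or_pos m with rfl | h0
  · refine ⟨0, ?_⟩
    rw [hu0, h.projection_comp, if_pos rfl, h.hopping_initial, ContinuousLinearMap.comp_add,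
      h.projection_rightState one_pos (by omega), h.projection_leftState one_pos (by omega)]
    simp
  · exact (h.hopping_excursionSpan hm (hmem h0)).2

variable {u : ℕ → K →L[ℂ] K} (hu0 : u 0 = P) (huP : ∀ m, u m * P = u m)
  (hu : ∀ m, u (m + 1) = -(V * u m) +
    ∑ p ∈ Finset.HasAntidiagonal.antidiagonal m, u p.1 * V * u p.2)
include hu0 huP hu

omit [CompleteSpace E] h in
/-- The recursion on the ground space. The term of the convolution with `u 0 = P` turns `V` into
`(1 - P) V`, and the others contain the effective operators `P V u j` of lower order. -/
theorem recursion_comp_site_zero (m : ℕ) : u (m + 1) ∘L s 0 = -((1 - P) ∘L V ∘L u m ∘L s 0) +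
    ∑ i ∈ Finset.range m, u (i + 1) ∘L P ∘L V ∘L u (m - (i + 1)) ∘L s 0 := by
  have h1 : ∀ p : ℕ × ℕ, u p.1 * V * u p.2 = u p.1 * P * V * u p.2 := fun p => by rw [huP]
  have h2 : u (m + 1) = -((1 - P) * V * u m) +
      ∑ i ∈ Finset.range m, u (i + 1) * P * V * u (m - (i + 1)) := by
    rw [hu, Finset.sum_congr rfl fun p _ => h1 p, Finset.Nat.sum_antidiagonal_eq_sum_range_succ_mk,
      Finset.sum_range_succ']
    simp only [huP, hu0, Nat.sub_zero, sub_mul, one_mul, mul_assoc]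
    rw [← mul_assoc P P, show P * P = P by simpa [hu0] using huP 0]
    abel
  rw [h2, ContinuousLinearMap.add_comp, ContinuousLinearMap.neg_comp,
    ContinuousLinearMap.finsetSum_comp]
  rfl

/-- Up to states within fewer hops, the `m`-th coefficient of the wave operator takes the clock
`m` sites straight up or straight down. -/
theorem comp_site_zero_sub_mem {m : ℕ} (h0 : 0 < m) (hm : m < n) :
    u m ∘L s 0 - (-1 : ℂ) ^ m • (rightState s Γ₀ M m + leftState s Γ₀ M m) ∈
      excursionSpan s Γ₀ M (m - 1) := by
  induction m using Nat.strong_induction_on with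
  | _ m ih =>
    obtain ⟨m, rfl⟩ : ∃ i, m = i + 1 := ⟨m - 1, by omega⟩
    have hmem : ∀ j, 0 < j → j ≤ m → u j ∘L s 0 ∈ excursionSpan s Γ₀ M j := fun j hj0 hj => by
      have h1 := excursionSpan_mono (Nat.sub_le j 1) (ih j (by omega) hj0 (by omega))
      have h2 : (-1 : ℂ) ^ j • (rightState s Γ₀ M j + leftState s Γ₀ M j) ∈
          excursionSpan s Γ₀ M j :=
        Submodule.smul_mem _ _ (Submodule.add_mem _ (rightState_mem hj0 le_rfl)
          (leftState_mem hj0 le_rfl))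
      simpa using Submodule.add_mem _ h1 h2
    have hsum : ∑ i ∈ Finset.range m, u (i + 1) ∘L P ∘L V ∘L u (m - (i + 1)) ∘L s 0 ∈
        excursionSpan s Γ₀ M m := by
      refine Submodule.sum_mem _ fun i hi => ?_
      have hi' := Finset.mem_range.1 hi
      obtain ⟨c, hc⟩ := h.effective_scalar_of_mem hu0 (m := m - (i + 1)) (by omega)
        fun hpos => hmem _ hpos (by omega)
      have h3 : u (i + 1) ∘L (s 0 ∘L Γ₀) = u (i + 1) ∘L s 0 := by
        conv_rhs => rw [← huP]
        change _ = u (i + 1) ∘L (P ∘L s 0)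
        rw [h.projection_comp, if_pos rfl]
      rw [hc, ContinuousLinearMap.comp_smul, h3]
      exact Submodule.smul_mem _ _ (excursionSpan_mono (by omega) (hmem _ (by omega) (by omega)))
    rw [recursion_comp_site_zero hu0 huP hu, Nat.add_sub_cancel]
    have hPR := h.projection_rightState (j := m + 1) (by omega) hm
    have hPL := h.projection_leftState (j := m + 1) (by omega) hm
    suffices hlead : -((1 - P) ∘L V ∘L u m ∘L s 0) -
        (-1 : ℂ) ^ (m + 1) • (rightState s Γ₀ M (m + 1) + leftState s Γ₀ M (m + 1)) ∈
          excursionSpan s Γ₀ M m by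
      have := Submodule.add_mem _ hlead hsum
      rwa [sub_add_eq_add_sub] at this
    rcases Nat.eq_zero_or_pos m with rfl | hm0
    · have hz : -((1 - P) ∘L V ∘L u 0 ∘L s 0) -
          (-1 : ℂ) ^ (0 + 1) • (rightState s Γ₀ M (0 + 1) + leftState s Γ₀ M (0 + 1)) = 0 := by
        rw [hu0, h.projection_comp, if_pos rfl, h.hopping_initial, ContinuousLinearMap.comp_add,
          one_sub_comp_eq_self hPR, one_sub_comp_eq_self hPL]
        module
      rw [hz]
      exact Submodule.zero_mem _
    · have hrest := (h.hopping_excursionSpan (k := m - 1) (by omega)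
        (ih m (by omega) hm0 (by omega))).1
      obtain ⟨v, hv, hvret⟩ := h.hopping_rightState hm0 (by omega)
      obtain ⟨w, hw, hwret⟩ := h.hopping_leftState hm0 (by omega)
      rw [Nat.sub_add_cancel hm0, ContinuousLinearMap.comp_sub, ContinuousLinearMap.comp_sub,
        ContinuousLinearMap.comp_smul, ContinuousLinearMap.comp_smul, ContinuousLinearMap.comp_add,
        hv, hw, ContinuousLinearMap.comp_add, ContinuousLinearMap.comp_add,
        ContinuousLinearMap.comp_add, one_sub_comp_eq_self hPR, one_sub_comp_eq_self hPL] at hrest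
      have hvw := Submodule.smul_mem _ ((-1 : ℂ) ^ m) (Submodule.add_mem _ hvret.1 hwret.1)
      have := Submodule.neg_mem _ (Submodule.add_mem _ hrest hvw)
      convert this using 1
      rw [pow_succ]
      module

theorem comp_site_zero_mem {m : ℕ} (h0 : 0 < m) (hm : m < n) :
    u m ∘L s 0 ∈ excursionSpan s Γ₀ M m := by
  have h1 := excursionSpan_mono (Nat.sub_le m 1) (h.comp_site_zero_sub_mem hu0 huP hu h0 hm)
  have h2 : (-1 : ℂ) ^ m • (rightState s Γ₀ M m + leftState s Γ₀ M m) ∈ excursionSpan s Γ₀ M m :=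
    Submodule.smul_mem _ _ (Submodule.add_mem _ (rightState_mem h0 le_rfl)
      (leftState_mem h0 le_rfl))
  simpa using Submodule.add_mem _ h1 h2

/-- Below order `n` the effective operators are scalar on the ground space. -/
theorem effective_scalar {m : ℕ} (hm : m + 1 < n) :
    ∃ c : ℂ, P ∘L V ∘L u m ∘L s 0 = c • (s 0 ∘L Γ₀) :=
  h.effective_scalar_of_mem hu0 hm fun h0 => h.comp_site_zero_mem hu0 huP hu h0 (by omega)

/-- At order `n` the clock can go once around the cycle, in either direction; this yields the target
Hamiltonian, and all other contributions are scalar. -/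
theorem effective_target : ∃ c : ℂ, P ∘L V ∘L u (n - 1) ∘L s 0 =
    c • (s 0 ∘L Γ₀) + (-1 : ℂ) ^ (n - 1) • (s 0 ∘L targetHamiltonian Γ₀ M) := by
  have hR : P ∘L rightState s Γ₀ M n = s 0 ∘L (Γ₀ * rightProd Γ₀ M n) := by
    rw [rightState, rightSite_self, ← ContinuousLinearMap.comp_assoc, h.projection_comp,
      if_pos rfl]
    rfl
  have hL : P ∘L leftState s Γ₀ M n = s 0 ∘L (Γ₀ * leftProd Γ₀ M n) := by
    rw [leftState, leftSite_self, ← ContinuousLinearMap.comp_assoc, h.projection_comp,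
      if_pos rfl]
    rfl
  have hT : s 0 ∘L targetHamiltonian Γ₀ M =
      P ∘L rightState s Γ₀ M n + P ∘L leftState s Γ₀ M n := by
    rw [hR, hL, targetHamiltonian_eq, ContinuousLinearMap.comp_add, add_comm]
  have hn := Nat.pos_of_neZero n
  rw [hT]
  rcases Nat.eq_or_lt_of_le (Nat.succ_le_of_lt hn) with h1 | h1
  · obtain rfl : n = 1 := h1.symm
    refine ⟨0, ?_⟩
    rw [Nat.sub_self, hu0, h.projection_comp, if_pos rfl, h.hopping_initial,
      ContinuousLinearMap.comp_add]
    simp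
  · have hlead := h.comp_site_zero_sub_mem hu0 huP hu (m := n - 1) (by omega) (by omega)
    obtain ⟨c, hc⟩ := (h.hopping_excursionSpan (by omega) hlead).2
    obtain ⟨v, hv, -, a, ha⟩ := h.hopping_rightState (j := n - 1) (by omega) (by omega)
    obtain ⟨w, hw, -, b, hb⟩ := h.hopping_leftState (j := n - 1) (by omega) (by omega)
    rw [Nat.sub_add_cancel hn] at hv hw
    refine ⟨c + (-1 : ℂ) ^ (n - 1) * (a + b), ?_⟩
    rw [ContinuousLinearMap.comp_sub, ContinuousLinearMap.comp_sub,
        ContinuousLinearMap.comp_smul, ContinuousLinearMap.comp_smul, ContinuousLinearMap.comp_add,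
        hv, hw, ContinuousLinearMap.comp_add, ContinuousLinearMap.comp_add,
        ContinuousLinearMap.comp_add, ha, hb, sub_eq_iff_eq_add] at hc
    rw [hc]
    module

end IsClockModel

end Excursions

/-! ### Summation of the series and the gadget -/

section Series

variable {K : Type*} [NormedAddCommGroup K] [InnerProductSpace ℂ K] {P V : K →L[ℂ] K}

theorem norm_smul_blochU_succ_le (hP : ‖P‖ ≤ 1) (hQ : ‖1 - P‖ ≤ 1) {t : ℝ}
    (ht : |t| * ‖V‖ ≤ 1 / 8) (m : ℕ) :
    ‖(t : ℂ) ^ (m + 1) • blochU ![0, 1] ![P, 1 - P] V (m + 1)‖ ≤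
      2 * (|t| * ‖V‖) * (1 / 2) ^ m := by
  rw [norm_smul, norm_pow, Complex.norm_real, Real.norm_eq_abs]
  calc _ ≤ |t| ^ (m + 1) * (2 * ‖V‖ * (4 * ‖V‖) ^ m) := by
        gcongr; exact norm_blochU_succ_le P V hP hQ m
    _ = 2 * (|t| * ‖V‖) * (4 * (|t| * ‖V‖)) ^ m := by simp only [mul_pow, pow_succ]; ring
    _ ≤ _ := by gcongr; linarith

theorem norm_smul_blochA_le (hP : ‖P‖ ≤ 1) (hQ : ‖1 - P‖ ≤ 1) {t : ℝ}
    (ht : |t| * ‖V‖ ≤ 1 / 8) {n : ℕ} (hn : 0 < n) (k : ℕ) :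
    ‖(t : ℂ) ^ (k + (n + 1)) • blochA ![0, 1] ![P, 1 - P] V (k + (n + 1))‖ ≤
      |t| ^ (n + 1) * (‖V‖ * (4 * ‖V‖) ^ n) * (1 / 2) ^ k := by
  obtain ⟨n, rfl⟩ : ∃ i, n = i + 1 := ⟨n - 1, by omega⟩
  rw [norm_smul, norm_pow, Complex.norm_real, Real.norm_eq_abs, ← add_assoc, blochA_succ_eq]
  have h1 : ‖blochU ![0, 1] ![P, 1 - P] V (k + (n + 1))‖ ≤ (4 * ‖V‖) ^ (k + (n + 1)) := by
    refine (norm_blochU_succ_le P V hP hQ (k + n)).trans ?_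
    rw [← add_assoc, pow_succ, mul_comm]
    gcongr
    norm_num
  have h2 : ‖P * V‖ ≤ ‖V‖ := (norm_mul_le _ _).trans (by nlinarith [norm_nonneg V])
  calc _ ≤ |t| ^ (k + (n + 1) + 1) * (‖V‖ * (4 * ‖V‖) ^ (k + (n + 1))) := by
        gcongr
        exact (norm_mul_le _ _).trans (by gcongr)
    _ = |t| ^ (n + 1 + 1) * (‖V‖ * (4 * ‖V‖) ^ (n + 1)) * (4 * (|t| * ‖V‖)) ^ k := by
        simp only [mul_pow, pow_succ, pow_add]; ring
    _ ≤ _ := by gcongr; linarith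

variable [CompleteSpace K]

theorem summable_norm_blochU (hP : IsStarProjection P) {t : ℝ} (ht : |t| * ‖V‖ ≤ 1 / 8) :
    Summable fun m => ‖(t : ℂ) ^ m • blochU ![0, 1] ![P, 1 - P] V m‖ := by
  refine (summable_nat_add_iff 1).1 ?_
  exact Summable.of_nonneg_of_le (fun _ => norm_nonneg _)
    (norm_smul_blochU_succ_le hP.norm_le hP.one_sub.norm_le ht)
    (summable_geometric_two.mul_left _)

theorem summable_norm_blochA (hP : IsStarProjection P) {t : ℝ} (ht : |t| * ‖V‖ ≤ 1 / 8) :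
    Summable fun m => ‖(t : ℂ) ^ m • blochA ![0, 1] ![P, 1 - P] V m‖ := by
  refine (summable_nat_add_iff (1 + 1)).1 ?_
  exact Summable.of_nonneg_of_le (fun _ => norm_nonneg _)
    (norm_smul_blochA_le hP.norm_le hP.one_sub.norm_le ht one_pos)
    (summable_geometric_two.mul_left _)

theorem hasSum_blochA {t : ℝ} {X : K →L[ℂ] K}
    (hX : HasSum (fun m => (t : ℂ) ^ m • blochU ![0, 1] ![P, 1 - P] V m) X) :
    HasSum (fun m => (t : ℂ) ^ m • blochA ![0, 1] ![P, 1 - P] V m) (P * ((t : ℂ) • V) * X) := by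
  refine (hasSum_nat_add_iff' 1).1 ?_
  have h0 : blochA ![0, 1] ![P, 1 - P] V 0 = 0 := rfl
  simp only [Finset.range_one, Finset.sum_singleton, h0, smul_zero, sub_zero]
  have h : ∀ m : ℕ, (t : ℂ) ^ (m + 1) • blochA ![0, 1] ![P, 1 - P] V (m + 1) =
      P * ((t : ℂ) • V) * (t : ℂ) ^ m • blochU ![0, 1] ![P, 1 - P] V m := fun m => by
    rw [blochA_succ_eq, mul_smul_comm, mul_smul_comm, smul_mul_assoc, smul_smul, pow_succ]
  simp only [h]
  exact hX.mul_left (P * ((t : ℂ) • V))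

theorem norm_sub_le_of_hasSum_blochU (hP : IsStarProjection P) {t : ℝ} (ht : |t| * ‖V‖ ≤ 1 / 8)
    {X : K →L[ℂ] K} (hX : HasSum (fun m => (t : ℂ) ^ m • blochU ![0, 1] ![P, 1 - P] V m) X) :
    ‖X - P‖ ≤ 4 * (|t| * ‖V‖) := by
  have h1 := (hasSum_nat_add_iff' 1).2 hX
  simp only [Finset.range_one, Finset.sum_singleton, pow_zero, one_smul, blochU_zero] at h1
  refine (h1.norm_le_of_bounded (hasSum_geometric_two.mul_left (2 * (|t| * ‖V‖)))
    (norm_smul_blochU_succ_le hP.norm_le hP.one_sub.norm_le ht)).trans (le_of_eq (by ring))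

theorem isBlochWave_of_hasSum (hP : IsStarProjection P) (hV : IsSelfAdjoint V) {t : ℝ}
    (ht : |t| * ‖V‖ ≤ 1 / 8) {X : K →L[ℂ] K}
    (hX : HasSum (fun m => (t : ℂ) ^ m • blochU ![0, 1] ![P, 1 - P] V m) X) :
    IsBlochWave P ((t : ℂ) • V) X where
  isStarProjection := hP
  isSelfAdjoint := by
    rw [IsSelfAdjoint, star_smul, hV.star_eq, Complex.star_def, Complex.conj_ofReal]
  self_mul := by
    refine (hX.mul_left P).unique ?_
    have h : HasSum (fun m => P * (t : ℂ) ^ m • blochU ![0, 1] ![P, 1 - P] V m) _ :=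
      hasSum_single 0 fun m hm => by
        obtain ⟨m, rfl⟩ := Nat.exists_eq_succ_of_ne_zero hm
        rw [mul_smul_comm, self_mul_blochU_succ P V hP.isIdempotentElem.eq, smul_zero]
    simpa [blochU_zero, hP.isIdempotentElem.eq] using h
  mul_self := by
    refine (hX.mul_right P).unique ?_
    simpa only [smul_mul_assoc, blochU_mul_self P V hP.isIdempotentElem.eq] using hX
  equation := by
    have h := bloch_equation_of_recursion (W := (t : ℂ) • V) (summable_norm_blochU hP ht) hX
      fun m => ?_
    · simpa [blochU_zero] using h
    rw [blochU_succ, smul_add, smul_neg, Finset.smul_sum]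
    congr 1
    · rw [smul_mul_smul_comm, pow_succ']
    · refine Finset.sum_congr rfl fun p hp => ?_
      rw [smul_mul_smul_comm, smul_mul_smul_comm, ← Finset.HasAntidiagonal.mem_antidiagonal.1 hp]
      congr 1
      ring
  norm_perturbation_le := by
    rw [norm_smul, Complex.norm_real, Real.norm_eq_abs]; exact ht
  norm_sub_le := by
    linarith [norm_sub_le_of_hasSum_blochU hP ht hX]

end Series

section Gadget

variable {E K : Type*} [NormedAddCommGroup E] [InnerProductSpace ℂ E] [CompleteSpace E]
  [NormedAddCommGroup K] [InnerProductSpace ℂ K] {n : ℕ} [NeZero n]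
  {s : Fin n → E →L[ℂ] K} {Γ₀ : E →L[ℂ] E} {M : Fin n → E →L[ℂ] E} {P V T : K →L[ℂ] K}

theorem IsClockModel.exists_blochA_eq (h : IsClockModel s Γ₀ M P V) (hP : P * P = P)
    (hs : ∀ A B : K →L[ℂ] K, (∀ k, A ∘L s k = B ∘L s k) → A = B)
    (hT : ∀ k, T ∘L s k = if 0 = k then s 0 ∘L targetHamiltonian Γ₀ M else 0) :
    ∃ c : ℕ → ℂ, ∀ m ≤ n, blochA ![0, 1] ![P, 1 - P] V m =
      c m • P + if m = n then (-1 : ℂ) ^ (n - 1) • T else 0 := by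
  have hstep : ∀ m (A : K →L[ℂ] K), A ∘L s 0 = (P * V * blochU ![0, 1] ![P, 1 - P] V m) ∘L s 0 →
      (∀ k, 0 ≠ k → A ∘L s k = 0) → P * V * blochU ![0, 1] ![P, 1 - P] V m = A := by
    intro m A h0 hk
    refine hs _ _ fun k => ?_
    by_cases hk0 : 0 = k
    · rw [← hk0, h0]
    · rw [hk k hk0, ← blochU_mul_self P V hP]
      change (P * V * blochU ![0, 1] ![P, 1 - P] V m) ∘L (P ∘L s k) = 0
      rw [h.projection_comp, if_neg hk0, ContinuousLinearMap.comp_zero]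
  have hex : ∀ m, ∃ c : ℂ, m ≤ n → blochA ![0, 1] ![P, 1 - P] V m =
      c • P + if m = n then (-1 : ℂ) ^ (n - 1) • T else 0 := by
    intro m
    rcases m with - | m
    · exact ⟨0, fun _ => by simp [blochA, (NeZero.ne n).symm]⟩
    by_cases hm : m + 1 ≤ n
    swap
    · exact ⟨0, fun h' => absurd h' hm⟩
    rcases hm.lt_or_eq with hlt | heq
    · obtain ⟨c, hc⟩ := h.effective_scalar (blochU_zero P V) (blochU_mul_self P V hP)
        (blochU_succ P V) hlt
      refine ⟨c, fun _ => ?_⟩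
      rw [if_neg hlt.ne, add_zero, blochA_succ_eq]
      refine hstep m _ ?_ fun k hk => ?_
      · rw [ContinuousLinearMap.smul_comp, h.projection_comp, if_pos rfl, ← hc]; rfl
      · rw [ContinuousLinearMap.smul_comp, h.projection_comp, if_neg hk, smul_zero]
    · obtain ⟨c, hc⟩ := h.effective_target (blochU_zero P V) (blochU_mul_self P V hP)
        (blochU_succ P V)
      refine ⟨c, fun _ => ?_⟩
      rw [if_pos heq, blochA_succ_eq]
      obtain rfl : m = n - 1 := by omega
      refine hstep _ _ ?_ fun k hk => ?_
      · rw [ContinuousLinearMap.add_comp, ContinuousLinearMap.smul_comp,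
          ContinuousLinearMap.smul_comp, h.projection_comp, hT, if_pos rfl, if_pos rfl, ← hc]
        rfl
      · rw [ContinuousLinearMap.add_comp, ContinuousLinearMap.smul_comp,
          ContinuousLinearMap.smul_comp, h.projection_comp, hT, if_neg hk, if_neg hk, smul_zero,
          smul_zero, add_zero]
  choose c hc using hex
  exact ⟨c, fun m hm => hc m hm⟩

variable [CompleteSpace K]

/-- The result for clock models. The energy shift is given by the real part of the scalar
contributions up to order `n`; the condition on `t` gives `4 |t| ‖V‖ ≤ 1/2`, so that the tails of
the series are bounded by geometric series of ratio `1/2`. -/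
theorem IsClockModel.effectiveHamiltonian_expansion (h : IsClockModel s Γ₀ M P V)
    (hP : IsStarProjection P) (hV : IsSelfAdjoint V)
    (hfin : FiniteDimensional ℂ (LinearMap.range P.toLinearMap))
    (hs : ∀ A B : K →L[ℂ] K, (∀ k, A ∘L s k = B ∘L s k) → A = B)
    (hT : ∀ k, T ∘L s k = if 0 = k then s 0 ∘L targetHamiltonian Γ₀ M else 0)
    (hTsa : IsSelfAdjoint T) :
    ∃ (f : ℝ → ℝ) (C : ℝ), ∀ t : ℝ, |t| * ‖V‖ ≤ 1 / 8 →
      Summable (fun m : ℕ => ‖(t : ℂ) ^ m • blochU ![0, 1] ![P, 1 - P] V m‖) ∧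
      Summable (fun m : ℕ => ‖(t : ℂ) ^ m • blochA ![0, 1] ![P, 1 - P] V m‖) ∧
      ∃ U A : K →L[ℂ] K,
        HasSum (fun m : ℕ => (t : ℂ) ^ m • blochU ![0, 1] ![P, 1 - P] V m) U ∧
        HasSum (fun m : ℕ => (t : ℂ) ^ m • blochA ![0, 1] ![P, 1 - P] V m) A ∧
        (∃ (φ : Fin (Module.finrank ℂ (LinearMap.range P.toLinearMap)) → K) (e : _ → ℝ),
          IsLowestEigenpairs (-P + (t : ℂ) • V) φ e) ∧
        ∀ (φ : Fin (Module.finrank ℂ (LinearMap.range P.toLinearMap)) → K) (e : _ → ℝ),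
          IsLowestEigenpairs (-P + (t : ℂ) • V) φ e →
          (∀ i, U (P (φ i)) = φ i ∧ A (P (φ i)) = ((e i + 1 : ℝ) : ℂ) • P (φ i)) ∧
          ‖shiftedEffectiveHamiltonian φ e (f t) - ((-1) ^ (n - 1) * (t : ℂ) ^ n) • T‖ ≤
            C * |t| ^ (n + 1) := by
  have hPP : P * P = P := hP.isIdempotentElem.eq
  obtain ⟨c, hc⟩ := h.exists_blochA_eq hPP hs hT
  have hΓT : Γ₀ * targetHamiltonian Γ₀ M = targetHamiltonian Γ₀ M := by
    simp only [targetHamiltonian, mul_add, ← mul_assoc, h.idem]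
  have hPT : P * T = T := hs _ _ fun k => by
    change P ∘L (T ∘L s k) = _
    rw [hT]
    split_ifs
    · rw [← ContinuousLinearMap.comp_assoc, h.projection_comp, if_pos rfl,
        ContinuousLinearMap.comp_assoc]
      congr 1
    · rw [ContinuousLinearMap.comp_zero]
  have hTP : T * P = T := by
    have := congrArg star hPT
    rwa [star_mul, hP.isSelfAdjoint.star_eq, hTsa.star_eq] at this
  refine ⟨fun t => (∑ m ∈ Finset.range (n + 1), (t : ℂ) ^ m * c m).re - 1,
    8 * ‖V‖ * ‖T‖ + 3 * (‖V‖ * (4 * ‖V‖) ^ n), fun t ht => ?_⟩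
  have hsU := summable_norm_blochU hP ht
  have hsA := summable_norm_blochA hP ht
  obtain ⟨X, hX⟩ := hsU.of_norm
  have hA := hasSum_blochA hX
  have hB := isBlochWave_of_hasSum hP hV ht hX
  refine ⟨hsU, hsA, X, P * ((t : ℂ) • V) * X, hX, hA, hB.exists_isLowestEigenpairs,
    fun φ e hφ => ⟨fun i => ⟨hB.apply_eigenvector hφ i, hB.effective_apply_eigenvector hφ i⟩, ?_⟩⟩
  set τ : ℝ := (-1) ^ (n - 1) * t ^ n with hτ
  have hτabs : |τ| = |t| ^ n := by simp [hτ, abs_mul]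
  have htail := (hasSum_nat_add_iff' (n + 1)).2 hA
  set B := P * ((t : ℂ) • V) * X -
    ∑ m ∈ Finset.range (n + 1), (t : ℂ) ^ m • blochA ![0, 1] ![P, 1 - P] V m with hBdef
  have hBnorm : ‖B‖ ≤ |t| ^ (n + 1) * (‖V‖ * (4 * ‖V‖) ^ n) * 2 :=
    htail.norm_le_of_bounded (hasSum_geometric_two.mul_left _)
      (norm_smul_blochA_le hP.norm_le hP.one_sub.norm_le ht (Nat.pos_of_neZero n))
  have hsum : ∑ m ∈ Finset.range (n + 1), (t : ℂ) ^ m • blochA ![0, 1] ![P, 1 - P] V m =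
      (∑ m ∈ Finset.range (n + 1), (t : ℂ) ^ m * c m) • P + (τ : ℂ) • T := by
    have h1 : ∀ m ∈ Finset.range (n + 1), (t : ℂ) ^ m • blochA ![0, 1] ![P, 1 - P] V m =
        ((t : ℂ) ^ m * c m) • P + if m = n then (τ : ℂ) • T else 0 := fun m hm => by
      rw [hc m (Nat.lt_succ_iff.1 (Finset.mem_range.1 hm)), smul_add, smul_smul]
      congr 1
      split_ifs with hmn
      · rw [hmn, smul_smul, hτ]
        push_cast
        rw [mul_comm]
      · rw [smul_zero]
    rw [Finset.sum_congr rfl h1, Finset.sum_add_distrib, ← Finset.sum_smul]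
    simp
  have hexp : P * ((t : ℂ) • V) * X =
      (∑ m ∈ Finset.range (n + 1), (t : ℂ) ^ m * c m) • P + (τ : ℂ) • T + B := by
    rw [← hsum, hBdef]; abel
  have hmain := hB.norm_shiftedEffectiveHamiltonian_sub_le hφ hTsa hTP hPT hexp
  have hε := norm_sub_le_of_hasSum_blochU hP ht hX
  have hτcast : ((-1) ^ (n - 1) * (t : ℂ) ^ n) = (τ : ℂ) := by rw [hτ]; push_cast; rfl
  rw [hτcast]
  refine hmain.trans ?_
  rw [hτabs]
  calc 2 * |t| ^ n * ‖T‖ * ‖X - P‖ + 3 / 2 * ‖B‖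
      ≤ 2 * |t| ^ n * ‖T‖ * (4 * (|t| * ‖V‖)) +
          3 / 2 * (|t| ^ (n + 1) * (‖V‖ * (4 * ‖V‖) ^ n) * 2) := by gcongr
    _ = _ := by ring

end Gadget

section Instantiation

theorem star_list_prod {R : Type*} [Monoid R] [StarMul R] (l : List R) :
    star l.prod = (l.reverse.map star).prod := by
  induction l with
  | nil => simp
  | cons a l ih => simp [ih]

variable {E : Type*} [NormedAddCommGroup E] [InnerProductSpace ℂ E] {n : ℕ}

/-- The embedding `y ↦ y ⊗ |j⟩`. -/
def siteEmbedding (j : Fin n) : E →L[ℂ] ClockSpace E n :=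
  (TensorProduct.mkL ℂ E (EuclideanSpace ℂ (Fin n))).flip (EuclideanSpace.single j 1)

variable [CompleteSpace E]

theorem isSelfAdjoint_targetHamiltonian {Γ₀ : E →L[ℂ] E} (hΓ : IsSelfAdjoint Γ₀)
    (M : Fin n → E →L[ℂ] E) : IsSelfAdjoint (targetHamiltonian Γ₀ M) := by
  have h1 : star (List.ofFn M).prod = (List.ofFn fun i => star (M i.rev)).prod := by
    rw [star_list_prod]
    congr 1
    refine List.ext_getElem (by simp) fun i h₁ h₂ => ?_
    simp only [List.getElem_map, List.getElem_reverse, List.getElem_ofFn, List.length_ofFn]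
    congr 2
    ext
    simp only [Fin.val_rev]
    omega
  rw [IsSelfAdjoint, targetHamiltonian, ← h1]
  simp [hΓ.star_eq, mul_assoc, add_comm]

variable [NeZero n]

theorem clockConstraints_of_unitary {Γ₀ : E →L[ℂ] E} (hΓ : Γ₀ * Γ₀ = Γ₀)
    {M : Fin n → E →L[ℂ] E} (hM : ∀ i, M i ∈ unitary (E →L[ℂ] E)) : ClockConstraints Γ₀ M := by
  have h1 : ∀ i, M i * star (M i) = 1 := fun i => (Unitary.mem_iff.1 (hM i)).2
  have h2 : ∀ i, star (M i) * M i = 1 := fun i => (Unitary.mem_iff.1 (hM i)).1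
  refine ⟨fun i => ⟨1, ?_⟩, fun i => ⟨1, ?_⟩, fun i => ⟨1, ?_⟩, ⟨1, ?_⟩⟩
  · rw [mul_assoc (M i), h1, mul_one, h1, one_pow, one_smul]
  · rw [h1, one_pow, one_smul]
  · rw [h1, h2, one_smul]
  · rw [mul_assoc Γ₀, h1, mul_one, hΓ, one_smul]

theorem isClockModel_hopping {Γ₀ : E →L[ℂ] E} (hΓ : IsStarProjection Γ₀)
    {M : Fin n → E →L[ℂ] E} (hM : ClockConstraints Γ₀ M) :
    IsClockModel siteEmbedding Γ₀ M (groundProjection Γ₀) (hopping M) where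
  idem := hΓ.isIdempotentElem.eq
  constraints := hM
  projection_comp k := by
    ext y
    change groundProjection Γ₀ (siteVector k y) = _
    rw [groundProjection_siteVector]
    split_ifs <;> rfl
  hopping_comp k := ContinuousLinearMap.ext fun y => hopping_siteVector M k y

end Instantiation

end ClockGadget

end

theorem theorem1 {E : Type*} [NormedAddCommGroup E] [InnerProductSpace ℂ E] [CompleteSpace E]
    {n : ℕ} [NeZero n] (Γ₀ : E →L[ℂ] E) (hΓ : IsStarProjection Γ₀)
    (hfin : FiniteDimensional ℂ (LinearMap.range Γ₀.toLinearMap))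
    (M : Fin n → E →L[ℂ] E) :
    ((∀ i, M i ∈ unitary (E →L[ℂ] E)) → ClockGadget.ClockConstraints Γ₀ M) ∧
    (ClockGadget.ClockConstraints Γ₀ M →
      ∃ (f : ℝ → ℝ) (C : ℝ), ∀ t : ℝ, 16 * |t| * (⨆ i, ‖M i‖) < 1 →
        -- absolute convergence of Bloch's series, with sums `U` and `A`
        Summable (fun m : ℕ => ‖(t : ℂ) ^ m • ClockGadget.clockU Γ₀ M m‖) ∧
        Summable (fun m : ℕ => ‖(t : ℂ) ^ m • ClockGadget.clockA Γ₀ M m‖) ∧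
        ∃ U A : ClockGadget.ClockSpace E n →L[ℂ] ClockGadget.ClockSpace E n,
          HasSum (fun m : ℕ => (t : ℂ) ^ m • ClockGadget.clockU Γ₀ M m) U ∧
          HasSum (fun m : ℕ => (t : ℂ) ^ m • ClockGadget.clockA Γ₀ M m) A ∧
          -- the lowest energy levels, as many as the rank of `P₀`, exist
          (∃ (φ : Fin (Module.finrank ℂ (LinearMap.range
                (ClockGadget.groundProjection (n := n) Γ₀).toLinearMap)) →
                ClockGadget.ClockSpace E n) (e : _ → ℝ),
            ClockGadget.IsLowestEigenpairs (ClockGadget.hamiltonian Γ₀ M t) φ e) ∧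
          -- and for every choice of their eigenvectors
          ∀ (φ : Fin (Module.finrank ℂ (LinearMap.range
                (ClockGadget.groundProjection (n := n) Γ₀).toLinearMap)) →
                ClockGadget.ClockSpace E n) (e : _ → ℝ),
            ClockGadget.IsLowestEigenpairs (ClockGadget.hamiltonian Γ₀ M t) φ e →
            -- the series represent the effective Hamiltonian (of the Hamiltonian shifted by `1`)
            (∀ i, U (ClockGadget.groundProjection Γ₀ (φ i)) = φ i ∧
              A (ClockGadget.groundProjection Γ₀ (φ i)) =
                ((e i + 1 : ℝ) : ℂ) • ClockGadget.groundProjection Γ₀ (φ i)) ∧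
            -- and the shifted effective Hamiltonian is the target up to `O(t^(n+1))`
            ‖ClockGadget.shiftedEffectiveHamiltonian φ e (f t) -
                ((-1) ^ (n - 1) * (t : ℂ) ^ n) • TensorProduct.mapL
                  (ClockGadget.targetHamiltonian Γ₀ M) (ClockGadget.ketBra 0 0)‖
              ≤ C * |t| ^ (n + 1)) := by
  refine ⟨ClockGadget.clockConstraints_of_unitary hΓ.isIdempotentElem.eq, fun hM => ?_⟩
  obtain ⟨f, C, h⟩ := (ClockGadget.isClockModel_hopping hΓ hM).effectiveHamiltonian_expansion
    (T := TensorProduct.mapL (ClockGadget.targetHamiltonian Γ₀ M) (ClockGadget.ketBra 0 0))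
    (ClockGadget.isStarProjection_groundProjection hΓ) (ClockGadget.isSelfAdjoint_hopping M)
    (ClockGadget.finiteDimensional_range_groundProjection hfin)
    (fun A B hAB => ClockGadget.ext_siteVector fun j y => DFunLike.congr_fun (hAB j) y)
    (fun k => by
      ext y
      refine (ClockGadget.mapL_ketBra_siteVector _ _ _ _ _).trans ?_
      split_ifs <;> rfl)
    (by
      rw [IsSelfAdjoint, ClockGadget.star_mapL_ketBra,
        (ClockGadget.isSelfAdjoint_targetHamiltonian hΓ.isSelfAdjoint M).star_eq])
  refine ⟨f, C, fun t ht => h t ?_⟩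
  have := mul_le_mul_of_nonneg_left (ClockGadget.norm_hopping_le M) (abs_nonneg t)
  linarith
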